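/- Let $L>0$, let $q\ge 1$ be an integer and let $F:\mathbb R\to\mathbb C$ be an $L$-periodic piecewise $C^q$ function with $J$ jump points $\xi_1,\dots,\xi_J$ modulo $L$; that is, on every bounded open interval containing none of the points $\xi_j+nL$ ($n\in\mathbb Z$), $F$ coincides with a function that is $C^q$ on the closed interval. Let $\sigma:\mathbb R\to\mathbb R$ be a spectral filter of order $q$: $\sigma\in C^{q-1}(\mathbb R)$, $\sigma(0)=1$, $\sigma^{(\ell)}(0)=0$ for $1\le \ell\le q-1$, and $\sigma(\eta)=0$ for $|\eta|\ge 1$. Put $\omega_k=2\pi k/L$ and $\hat F_k=\frac1L\int_0^L F(y)e^{-i\omega_k y}\,dy$, and for a cutoff $\Omega>0$ let $$F^{\Omega,\sigma}(x)=\sum_{|\omega_k|\le\Omega}\hat F_k\,\sigma(\omega_k/\Omega)\,e^{i\omega_k x}$$ be the filtered spectral reconstruction of $F$ (for $\Omega=2\pi\nu/L$ this is the filtered partial sum over the $N=2\nu+1$ modes $|k|\le\nu$). Then for every real $p\ge 1$ with $p(q-1)>1$, $$\|F-F^{\Omega,\sigma}\|_{L^p([0,L])}=O(\Omega^{-1/p})\qquad(\Omega\to\infty),$$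 with an implied constant independent of $\Omega$. In particular, if $q-1>1$, then $\|F-F^{\Omega,\sigma}\|_{L^1([0,L])}=O(\Omega^{-1})$. -/

import Mathlib

open MeasureTheory Filter

/-- `F` is an `L`-periodic, piecewise `C^q` function whose break points, modulo the period `L`, are
among `ξ 0, …, ξ (J-1)`: on every bounded open interval that contains no point `ξ j + n L`, the
function `F` coincides with a `C^q` function defined up to (and beyond) the end points. So `F` and
its derivatives up to order `q` have finite one-sided limits at the break points, where they may
jump, and the values of `F` at the break points are arbitrary. -/
structure IsPeriodicPiecewiseContDiff (L : ℝ) (q : ℕ) {J : ℕ} (ξ : Fin J → ℝ) (F : ℝ → ℂ) :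
    Prop where
  periodic : Function.Periodic F L
  piecewise : ∀ a b : ℝ, a < b → (∀ (j : Fin J) (n : ℤ), ξ j + n * L ∉ Set.Ioo a b) →
    ∃ g : ℝ → ℂ, ContDiff ℝ q g ∧ Set.EqOn F g (Set.Ioo a b)

/-- `σ` is a real spectral filter of order `q`. -/
structure IsSpectralFilter (q : ℕ) (σ : ℝ → ℝ) : Prop where
  map_zero : σ 0 = 1
  iteratedDeriv_zero : ∀ l : ℕ, 1 ≤ l → l ≤ q - 1 → iteratedDeriv l σ 0 = 0
  eq_zero : ∀ η : ℝ, 1 ≤ |η| → σ η = 0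
  contDiff : ContDiff ℝ (q - 1 : ℕ) σ

/-- The filtered Fourier reconstruction of an `L`-periodic function `F` with frequency cutoff `Ω`:
with the frequencies `ω_k = 2πk/L`, the sum over all integers `k` with `|ω_k| ≤ Ω` of
`F̂_k σ(ω_k / Ω) exp(i ω_k x)`, where `F̂_k = (1/L) ∫_0^L F(y) exp(-i ω_k y) dy`. -/
noncomputable def filteredReconstruction {L : ℝ} (hL : 0 < L) (F : ℝ → ℂ) (σ : ℝ → ℝ)
    (Ω : ℝ) (x : ℝ) : ℂ :=
  ∑ k ∈ Finset.Icc (-⌊L * Ω / (2 * Real.pi)⌋) ⌊L * Ω / (2 * Real.pi)⌋,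
    fourierCoeffOn hL F k * (σ (2 * Real.pi * k / L / Ω) : ℂ) *
      Complex.exp (Complex.I * (2 * Real.pi * k / L : ℝ) * x)

/-- At the cutoff `Ω = 2πν/L` the reconstruction is the filtered partial sum with the
`N = 2ν + 1` Fourier modes `-ν, …, ν`. -/
theorem filteredReconstruction_nat {L : ℝ} (hL : 0 < L) (F : ℝ → ℂ) (σ : ℝ → ℝ)
    (ν : ℕ) (x : ℝ) :
    filteredReconstruction hL F σ (2 * Real.pi * ν / L) x =
      ∑ k ∈ Finset.Icc (-(ν : ℤ)) ν, fourierCoeffOn hL F k * (σ ((k : ℝ) / ν) : ℂ) *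
        Complex.exp (Complex.I * k * (2 * Real.pi / L) * x) := by
  have hpi := Real.pi_ne_zero
  have h1 : L * (2 * Real.pi * ν / L) / (2 * Real.pi) = ((ν : ℤ) : ℝ) := by
    push_cast
    field_simp
  unfold filteredReconstruction
  rw [h1, Int.floor_intCast]
  refine Finset.sum_congr rfl fun k _ => ?_
  have h2 : 2 * Real.pi * k / L / (2 * Real.pi * ν / L) = (k : ℝ) / ν := by
    rw [div_div_div_cancel_right₀ hL.ne', mul_div_mul_left _ _ (by positivity)]
  rw [h2]
  congr 2
  push_cast
  ring

/-!
Let `S` be the sawtooth wave, of slope `-1` and jump `L` at the multiples of `L`. Integrating by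
parts against `S (x - y)` writes a piecewise `C¹` function as a constant plus a superposition of
translates of `S`: one for each jump, and an average weighted by the derivative. The filtered
reconstruction is linear, commutes with translations and preserves constants, so by Minkowski's
inequality the error for `F` is at most a constant times the error for `S`.

The `k`-th Fourier coefficient of the error for `S` is `(1 - σ (ω / Ω)) / (i ω)` with
`ω = 2πk / L`. Since `σ` is flat at `0`, the `j`-th derivative of `(1 - σ η) / η` is
`O(|η|^(θ - 1 - j))` for all `j ≤ q - 1` and `0 ≤ θ ≤ q - 1`. Multiplying the error by
`(exp (-2πinx / L) - 1)^(q - 1)` replaces its coefficients by their differences of order `q - 1`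
with step `n`; for `0 < θ < q - 1` these are summable, and a choice of `n` comparable to
`1 / dist (x, L ℤ)` bounds the error by a multiple of `(Ω * dist (x, L ℤ))^(-θ)`. Using an exponent
`θ` just below `1 / p` where `Ω * dist (x, L ℤ) ≤ 1` and one just above it elsewhere, the `L^p` norm
is `O(Ω^(-1 / p))`.
-/

section FiniteDifferences

variable {E : Type*} [NormedAddCommGroup E] [NormedSpace ℝ E] {m : ℕ} {f : ℝ → E} {x h B : ℝ}

theorem hasDerivAt_fwdDiff_iter (hf : ∀ i ≤ m, DifferentiableAt ℝ f (x + i • h)) :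
    HasDerivAt ((fwdDiff h)^[m] f) ((fwdDiff h)^[m] (deriv f) x) x := by
  rw [funext (fwdDiff_iter_eq_sum_shift h f m), fwdDiff_iter_eq_sum_shift]
  exact HasDerivAt.fun_sum fun i hi =>
    ((hf i (Finset.mem_range_succ_iff.1 hi)).hasDerivAt.comp_add_const x (i • h)).fun_const_smul _

theorem norm_fwdDiff_iter_le (hh : 0 ≤ h) (hf : ∀ t ∈ Set.Icc x (x + m * h), ContDiffAt ℝ m f t)
    (hB : ∀ t ∈ Set.Icc x (x + m * h), ‖iteratedDeriv m f t‖ ≤ B) :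
    ‖(fwdDiff h)^[m] f x‖ ≤ B * h ^ m := by
  induction m generalizing f x with
  | zero => simpa using hB x (by simp)
  | succ m ih =>
    have mem_of_mem : ∀ t ∈ Set.Icc x (x + h), ∀ u ∈ Set.Icc t (t + m * h),
        u ∈ Set.Icc x (x + (m + 1 : ℕ) * h) := fun t ht u hu => by
      push_cast
      exact ⟨ht.1.trans hu.1, by linarith [hu.2, ht.2]⟩
    have hderiv : ∀ t ∈ Set.Icc x (x + h),
        HasDerivAt ((fwdDiff h)^[m] f) ((fwdDiff h)^[m] (deriv f) t) t := fun t ht =>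
      hasDerivAt_fwdDiff_iter fun i hi => (hf _ (mem_of_mem t ht _ ⟨by
        simp only [nsmul_eq_mul, le_add_iff_nonneg_right]; positivity, by
        simp only [nsmul_eq_mul]; gcongr⟩)).differentiableAt (by simp)
    have hbound : ∀ t ∈ Set.Icc x (x + h), ‖(fwdDiff h)^[m] (deriv f) t‖ ≤ B * h ^ m := fun t ht =>
      ih (fun u hu => ((hf u (mem_of_mem t ht u hu)).fderiv_right_succ).clm_apply contDiffAt_const)
        fun u hu => by simpa only [iteratedDeriv_succ'] using hB u (mem_of_mem t ht u hu)
    have hmvt := (convex_Icc x (x + h)).norm_image_sub_le_of_norm_hasDerivWithin_le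
      (fun t ht => (hderiv t ht).hasDerivWithinAt) hbound
      (Set.left_mem_Icc.2 (by linarith)) (Set.right_mem_Icc.2 (by linarith))
    rw [Function.iterate_succ_apply', pow_succ, ← mul_assoc]
    rwa [add_sub_cancel_left, Real.norm_of_nonneg hh] at hmvt

theorem sum_norm_fwdDiff_iter_le (c : ℤ → E) (m n : ℕ) (s : Finset ℤ) {S : ℝ}
    (hS : ∀ i ≤ m, ∑ k ∈ s, ‖c (k + i * n)‖ ≤ S) :
    ∑ k ∈ s, ‖(fwdDiff (n : ℤ))^[m] c k‖ ≤ 2 ^ m * S := by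
  have hle (k : ℤ) : ‖(fwdDiff (n : ℤ))^[m] c k‖ ≤
      ∑ i ∈ Finset.range (m + 1), (m.choose i : ℝ) * ‖c (k + i * n)‖ := by
    rw [fwdDiff_iter_eq_sum_shift]
    refine norm_sum_le_of_le _ fun i _ => ?_
    rw [← Int.cast_smul_eq_zsmul ℝ, norm_smul]
    simp
  calc ∑ k ∈ s, ‖(fwdDiff (n : ℤ))^[m] c k‖
      ≤ ∑ k ∈ s, ∑ i ∈ Finset.range (m + 1), (m.choose i : ℝ) * ‖c (k + i * n)‖ :=
        Finset.sum_le_sum fun k _ => hle k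
    _ = ∑ i ∈ Finset.range (m + 1), (m.choose i : ℝ) * ∑ k ∈ s, ‖c (k + i * n)‖ := by
        rw [Finset.sum_comm]
        simp only [Finset.mul_sum]
    _ ≤ ∑ i ∈ Finset.range (m + 1), (m.choose i : ℝ) * S := by
        gcongr with i hi
        exact hS i (Finset.mem_range_succ_iff.1 hi)
    _ = 2 ^ m * S := by
        rw [← Finset.sum_mul, ← Nat.cast_sum, Nat.sum_range_choose, Nat.cast_pow, Nat.cast_ofNat]

end FiniteDifferences

section PowerSums

theorem sum_Ioc_rpow_sub_one_le {s : ℝ} (hs1 : s ≤ 1) (hs0 : s ≠ 0) {a b : ℕ} (ha : 0 < a)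
    (hab : a ≤ b) : ∑ j ∈ Finset.Ioc a b, (j : ℝ) ^ (s - 1) ≤ ((b : ℝ) ^ s - (a : ℝ) ^ s) / s := by
  have ha' : (0 : ℝ) < a := Nat.cast_pos.2 ha
  have hanti : AntitoneOn (fun x : ℝ => x ^ (s - 1)) (Set.Icc a b) := fun x hx y _ hxy =>
    Real.rpow_le_rpow_of_nonpos (ha'.trans_le hx.1) hxy (by linarith)
  calc ∑ j ∈ Finset.Ioc a b, (j : ℝ) ^ (s - 1)
      = ∑ j ∈ Finset.Ico a b, ((j + 1 : ℕ) : ℝ) ^ (s - 1) := by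
        rw [Finset.sum_Ico_add' (fun j : ℕ => (j : ℝ) ^ (s - 1)),
          Finset.Ico_add_one_add_one_eq_Ioc]
    _ ≤ ∫ x in a..b, x ^ (s - 1) := hanti.sum_le_integral_Ico hab
    _ = _ := by
        rw [integral_rpow (Or.inr ⟨by simpa [sub_eq_iff_eq_add] using hs0,
          fun h => ha'.not_ge (Set.uIcc_of_le (Nat.cast_le (α := ℝ).2 hab) ▸ h).1⟩), sub_add_cancel]

theorem sum_Icc_rpow_sub_one_le {s : ℝ} (hs : 0 < s) (N : ℕ) :
    ∑ j ∈ Finset.Icc 1 N, (j : ℝ) ^ (s - 1) ≤ (1 + 1 / s) * (N : ℝ) ^ s := by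
  rcases N.eq_zero_or_pos with rfl | hN
  · simp [hs.ne']
  have hN' : (1 : ℝ) ≤ N := Nat.one_le_cast.2 hN
  rcases le_total s 1 with hs1 | hs1
  · rw [Finset.Icc_eq_cons_Ioc hN, Finset.sum_cons]
    have h := sum_Ioc_rpow_sub_one_le hs1 hs.ne' one_pos hN
    have : (1 : ℝ) ≤ (N : ℝ) ^ s := Real.one_le_rpow hN' hs.le
    simp only [Nat.cast_one, Real.one_rpow] at h ⊢
    rw [add_mul, one_mul, one_div_mul_eq_div]
    gcongr
    exact h.trans (by gcongr; linarith)
  · calc ∑ j ∈ Finset.Icc 1 N, (j : ℝ) ^ (s - 1)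
        ≤ ∑ _j ∈ Finset.Icc 1 N, (N : ℝ) ^ (s - 1) := by
          refine Finset.sum_le_sum fun j hj => Real.rpow_le_rpow j.cast_nonneg
            (Nat.cast_le.2 (Finset.mem_Icc.1 hj).2) (by linarith)
      _ = (N : ℝ) ^ s := by
          rw [Finset.sum_const, Nat.card_Icc, add_tsub_cancel_right, nsmul_eq_mul,
            Real.rpow_sub_one (by positivity), mul_div_cancel₀ _ (by positivity)]
      _ ≤ _ := le_mul_of_one_le_left (by positivity) (by simp [hs.le])

theorem sum_natAbs_le_two_mul_sum {s : Finset ℤ} {t : Finset ℕ} {g : ℕ → ℝ} (hg : ∀ j, 0 ≤ g j)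
    (hst : ∀ k ∈ s, k.natAbs ∈ t) : ∑ k ∈ s, g k.natAbs ≤ 2 * ∑ j ∈ t, g j := by
  rw [← Finset.sum_fiberwise_of_maps_to hst, Finset.mul_sum]
  refine Finset.sum_le_sum fun j _ => ?_
  have hcard : (s.filter fun k => k.natAbs = j).card ≤ 2 :=
    (Finset.card_le_card (t := {(j : ℤ), -(j : ℤ)}) fun k hk => by
      simpa using Int.natAbs_eq_iff.1 (Finset.mem_filter.1 hk).2).trans Finset.card_le_two
  calc ∑ k ∈ s with k.natAbs = j, g k.natAbs
      = ∑ k ∈ s with k.natAbs = j, g j :=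
        Finset.sum_congr rfl fun k hk => by rw [(Finset.mem_filter.1 hk).2]
    _ = (s.filter fun k => k.natAbs = j).card * g j := by rw [Finset.sum_const, nsmul_eq_mul]
    _ ≤ 2 * g j := by gcongr; exacts [hg j, mod_cast hcard]

theorem sum_abs_rpow_sub_one_le {s : ℝ} (hs : 0 < s) {N : ℕ} {t : Finset ℤ}
    (ht : ∀ k ∈ t, k ≠ 0 ∧ |k| ≤ N) :
    ∑ k ∈ t, |(k : ℝ)| ^ (s - 1) ≤ 2 * ((1 + 1 / s) * (N : ℝ) ^ s) := by
  simp only [← Int.cast_abs, ← Nat.cast_natAbs]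
  refine (sum_natAbs_le_two_mul_sum (t := Finset.Icc 1 N) (g := fun j => (j : ℝ) ^ (s - 1))
    (fun j => by positivity) fun k hk => ?_).trans (by gcongr; exact sum_Icc_rpow_sub_one_le hs N)
  have := ht k hk
  rw [Int.abs_eq_natAbs] at this
  rw [Finset.mem_Icc]
  omega

theorem sum_abs_rpow_neg_sub_one_le {r : ℝ} (hr : 0 < r) {N : ℕ} (hN : 0 < N) {t : Finset ℤ}
    (ht : ∀ k ∈ t, (N : ℤ) < |k|) :
    ∑ k ∈ t, |(k : ℝ)| ^ (-r - 1) ≤ 2 * ((N : ℝ) ^ (-r) / r) := by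
  obtain ⟨K, hK⟩ : ∃ K : ℕ, ∀ k ∈ t, k.natAbs ≤ K :=
    ⟨t.sup Int.natAbs, fun k hk => Finset.le_sup (f := Int.natAbs) hk⟩
  have hsum : ∑ j ∈ Finset.Ioc N (max N K), (j : ℝ) ^ (-r - 1) ≤ (N : ℝ) ^ (-r) / r := by
    refine (sum_Ioc_rpow_sub_one_le (by linarith) (neg_ne_zero.2 hr.ne') hN
      (le_max_left N K)).trans ?_
    rw [div_neg, ← neg_div, neg_sub]
    gcongr
    exact sub_le_self _ (by positivity)
  simp only [← Int.cast_abs, ← Nat.cast_natAbs]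
  refine (sum_natAbs_le_two_mul_sum (t := Finset.Ioc N (max N K))
    (g := fun j => (j : ℝ) ^ (-r - 1)) (fun j => by positivity) fun k hk => ?_).trans (by gcongr)
  have hkN := ht k hk
  have hkK := hK k hk
  rw [Int.abs_eq_natAbs] at hkN
  rw [Finset.mem_Ioc]
  omega

end PowerSums

section SymbolBounds

theorem norm_le_mul_pow_of_iteratedDeriv_zero {E : Type*} [NormedAddCommGroup E] [NormedSpace ℝ E]
    {m : ℕ} {f : ℝ → E} {M t : ℝ} (hf : ContDiff ℝ m f) (h0 : ∀ j < m, iteratedDeriv j f 0 = 0)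
    (hM : ∀ u, |u| ≤ |t| → ‖iteratedDeriv m f u‖ ≤ M) : ‖f t‖ ≤ M * |t| ^ m := by
  induction m generalizing f t with
  | zero => simpa using hM t le_rfl
  | succ m ih =>
    have hderiv : ∀ u ∈ Set.uIcc 0 t, ‖deriv f u‖ ≤ M * |t| ^ m := fun u hu => by
      have hut : |u| ≤ |t| := by simpa using Set.abs_sub_left_of_mem_uIcc hu
      have hM0 : 0 ≤ M := (norm_nonneg _).trans (hM t le_rfl)
      refine (ih (contDiff_succ_iff_deriv.1 hf).2.2 (fun j hj => ?_) fun v hv => ?_).trans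
        (by gcongr)
      · simpa only [iteratedDeriv_succ'] using h0 (j + 1) (by omega)
      · simpa only [iteratedDeriv_succ'] using hM v (hv.trans hut)
    have hmvt := (convex_uIcc 0 t).norm_image_sub_le_of_norm_deriv_le
      (fun u _ => (hf.differentiable (by simp)).differentiableAt) hderiv Set.left_mem_uIcc
      Set.right_mem_uIcc
    simpa [show f 0 = 0 by simpa using h0 0 m.succ_pos, pow_succ, mul_assoc] using hmvt

/-- `f` is a homogeneous symbol of order `s` with `m` controlled derivatives: away from the origin,
where no condition is imposed, `f` is `C^m` and its `j`-th derivative is at most `A |t|^(s - j)`. -/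
structure HasSymbolBound (m : ℕ) (s A : ℝ) (f : ℝ → ℝ) : Prop where
  contDiffAt : ∀ t ≠ 0, ContDiffAt ℝ m f t
  norm_iteratedDeriv_le : ∀ j ≤ m, ∀ t ≠ 0, ‖iteratedDeriv j f t‖ ≤ A * |t| ^ (s - j)

namespace HasSymbolBound

variable {m : ℕ} {s A B : ℝ} {f g : ℝ → ℝ}

theorem nonneg (hf : HasSymbolBound m s A f) : 0 ≤ A := by
  simpa using (norm_nonneg _).trans (hf.norm_iteratedDeriv_le 0 m.zero_le 1 one_ne_zero)

theorem norm_le (hf : HasSymbolBound m s A f) {t : ℝ} (ht : t ≠ 0) : ‖f t‖ ≤ A * |t| ^ s := by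
  simpa using hf.norm_iteratedDeriv_le 0 m.zero_le t ht

theorem mul {s' : ℝ} (hf : HasSymbolBound m s A f) (hg : HasSymbolBound m s' B g) :
    HasSymbolBound m (s + s') (2 ^ m * (A * B)) (f * g) where
  contDiffAt t ht := (hf.contDiffAt t ht).mul (hg.contDiffAt t ht)
  norm_iteratedDeriv_le j hj t ht := by
    have hjm : (j : WithTop ℕ∞) ≤ m := by exact_mod_cast hj
    rw [iteratedDeriv_mul ((hf.contDiffAt t ht).of_le hjm) ((hg.contDiffAt t ht).of_le hjm)]
    have hterm : ∀ i ∈ Finset.range (j + 1),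
        ‖j.choose i * iteratedDeriv i f t * iteratedDeriv (j - i) g t‖ ≤
          j.choose i * (A * B * |t| ^ (s + s' - j)) := fun i hi => by
      have hij := Finset.mem_range_succ_iff.1 hi
      have hpow : |t| ^ (s + s' - j) = |t| ^ (s - i) * |t| ^ (s' - (j - i : ℕ)) := by
        rw [← Real.rpow_add (abs_pos.2 ht), Nat.cast_sub hij]
        ring_nf
      rw [hpow, mul_mul_mul_comm, norm_mul, norm_mul, RCLike.norm_natCast, mul_assoc]
      have hA := hf.nonneg
      gcongr
      · exact hf.norm_iteratedDeriv_le i (hij.trans hj) t ht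
      · exact hg.norm_iteratedDeriv_le (j - i) (by omega) t ht
    refine (norm_sum_le_of_le _ hterm).trans ?_
    rw [← Finset.sum_mul, ← Nat.cast_sum, Nat.sum_range_choose, Nat.cast_pow, Nat.cast_ofNat,
      ← mul_assoc]
    have hAB := mul_nonneg hf.nonneg hg.nonneg
    gcongr
    norm_num

theorem inv (m : ℕ) : HasSymbolBound m (-1) m.factorial Inv.inv where
  contDiffAt t ht := contDiffAt_inv ℝ ht
  norm_iteratedDeriv_le j hj t _ := by
    rw [iteratedDeriv_eq_iterate, iter_deriv_inv, norm_mul, norm_mul, norm_pow, norm_neg, norm_one,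
      one_pow, one_mul, norm_zpow, Real.norm_eq_abs, Real.norm_eq_abs, ← Real.rpow_intCast,
      Nat.abs_cast]
    push_cast
    gcongr

end HasSymbolBound

theorem IsSpectralFilter.exists_norm_iteratedDeriv_one_sub_le {q : ℕ} {σ : ℝ → ℝ}
    (hσ : IsSpectralFilter q σ) : ∃ M : ℝ, ∀ j ≤ q - 1, ∀ t, |t| ≤ 1 →
      ‖iteratedDeriv j (fun t => 1 - σ t) t‖ ≤ M * |t| ^ (q - 1 - j) := by
  have hσ' : ContDiff ℝ (q - 1 : ℕ) fun t => 1 - σ t := contDiff_const.sub hσ.contDiff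
  obtain ⟨M, hM⟩ := isCompact_Icc.exists_bound_of_continuousOn
    (hσ'.continuous_iteratedDeriv' (q - 1)).continuousOn (s := Set.Icc (-1 : ℝ) 1)
  have iteratedDeriv_iteratedDeriv : ∀ i j, iteratedDeriv i (iteratedDeriv j fun t => 1 - σ t) =
      iteratedDeriv (i + j) fun t => 1 - σ t := fun i j => by
    simp only [iteratedDeriv_eq_iterate, Function.iterate_add_apply]
  refine ⟨M, fun j hj t ht => norm_le_mul_pow_of_iteratedDeriv_zero ?_ (fun i hi => ?_)
    fun u hu => ?_⟩
  · rw [iteratedDeriv_eq_iterate]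
    exact ContDiff.iterate_deriv' _ j (by rwa [Nat.sub_add_cancel hj])
  · rw [iteratedDeriv_iteratedDeriv]
    rcases (i + j).eq_zero_or_pos with hij | hij
    · simp [hij, hσ.map_zero]
    · rw [iteratedDeriv_const_sub hij, iteratedDeriv_neg, hσ.iteratedDeriv_zero _ hij (by omega),
        neg_zero]
  · rw [iteratedDeriv_iteratedDeriv, Nat.sub_add_cancel hj]
    exact hM u (abs_le.1 (hu.trans ht))

theorem IsSpectralFilter.exists_hasSymbolBound_one_sub {q : ℕ} {σ : ℝ → ℝ}
    (hσ : IsSpectralFilter q σ) : ∃ M : ℝ, ∀ s ∈ Set.Icc 0 ((q - 1 : ℕ) : ℝ),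
      HasSymbolBound (q - 1) s M fun t => 1 - σ t := by
  obtain ⟨M, hM⟩ := hσ.exists_norm_iteratedDeriv_one_sub_le
  refine ⟨max M 1, fun s hs => ⟨fun t _ => (contDiff_const.sub hσ.contDiff).contDiffAt,
    fun j hj t ht => ?_⟩⟩
  rcases le_or_gt |t| 1 with ht1 | ht1
  · calc ‖iteratedDeriv j (fun t => 1 - σ t) t‖
        ≤ M * |t| ^ (((q - 1 - j : ℕ) : ℝ)) := by simpa using hM j hj t ht1
      _ ≤ max M 1 * |t| ^ (s - j) := by
        rw [Nat.cast_sub hj]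
        gcongr ?_ * ?_
        · exact le_max_left M 1
        · exact Real.rpow_le_rpow_of_exponent_ge (abs_pos.2 ht) ht1 (by linarith [hs.2])
  · have hconst : (fun t => 1 - σ t) =ᶠ[nhds t] fun _ => 1 := by
      filter_upwards [continuous_abs.continuousAt.eventually_const_lt ht1] with u hu
      rw [hσ.eq_zero u hu.le, sub_zero]
    rw [hconst.iteratedDeriv_eq, iteratedDeriv_const]
    split_ifs with hj0
    · rw [norm_one, hj0, Nat.cast_zero, sub_zero]
      exact one_le_mul_of_one_le_of_one_le (le_max_right M 1) (Real.one_le_rpow ht1.le hs.1)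
    · rw [norm_zero]
      positivity

/-- The symbol `(1 - σ t) / t` of the error of the filtered reconstruction of a sawtooth: up to a
factor depending only on the cutoff, it gives the Fourier coefficients of that error. Division by
zero makes it vanish at `0`, in agreement with the vanishing mean of the sawtooth. -/
noncomputable def errorSymbol (σ : ℝ → ℝ) (t : ℝ) : ℝ := (1 - σ t) / t

theorem errorSymbol_zero (σ : ℝ → ℝ) : errorSymbol σ 0 = 0 := div_zero _

theorem IsSpectralFilter.exists_hasSymbolBound_errorSymbol {q : ℕ} {σ : ℝ → ℝ}
    (hσ : IsSpectralFilter q σ) : ∃ A : ℝ, ∀ s ∈ Set.Icc 0 ((q - 1 : ℕ) : ℝ),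
      HasSymbolBound (q - 1) (s - 1) A (errorSymbol σ) := by
  obtain ⟨M, hM⟩ := hσ.exists_hasSymbolBound_one_sub
  exact ⟨_, fun s hs => (hM s hs).mul (HasSymbolBound.inv (q - 1))⟩

namespace HasSymbolBound

variable {m : ℕ} {θ A h : ℝ} {f : ℝ → ℝ}

theorem sum_norm_le (hf : HasSymbolBound m (θ - 1) A f) (hf0 : f 0 = 0) (hθ : 0 < θ) (hh : 0 < h)
    {N : ℕ} {t : Finset ℤ} (ht : ∀ k ∈ t, |k| ≤ N) :
    ∑ k ∈ t, ‖f (h * k)‖ ≤ A * h ^ (θ - 1) * (2 * ((1 + 1 / θ) * (N : ℝ) ^ θ)) := by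
  have hA := hf.nonneg
  have hzero : ∀ k ∈ t, ‖f (h * k)‖ ≠ 0 → k ≠ 0 := by
    rintro k - hk rfl
    simp [hf0] at hk
  calc ∑ k ∈ t, ‖f (h * k)‖
      = ∑ k ∈ t with k ≠ 0, ‖f (h * k)‖ := (Finset.sum_filter_of_ne hzero).symm
    _ ≤ ∑ k ∈ t with k ≠ 0, A * h ^ (θ - 1) * |(k : ℝ)| ^ (θ - 1) :=
        Finset.sum_le_sum fun k hk => by
          have hk0 : h * k ≠ 0 := mul_ne_zero hh.ne' (by simpa using (Finset.mem_filter.1 hk).2)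
          refine (hf.norm_le hk0).trans_eq ?_
          rw [abs_mul, abs_of_pos hh, Real.mul_rpow hh.le (abs_nonneg _), mul_assoc]
    _ ≤ A * h ^ (θ - 1) * (2 * ((1 + 1 / θ) * (N : ℝ) ^ θ)) := by
        rw [← Finset.mul_sum]
        gcongr
        exact sum_abs_rpow_sub_one_le hθ fun k hk =>
          ⟨(Finset.mem_filter.1 hk).2, ht k (Finset.mem_filter.1 hk).1⟩

theorem sum_norm_fwdDiff_le_of_abs_le (hf : HasSymbolBound m (θ - 1) A f) (hf0 : f 0 = 0)
    (hθ : 0 < θ) (hh : 0 < h) {n R : ℕ} {t : Finset ℤ} (ht : ∀ k ∈ t, |k| ≤ R * n) :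
    ∑ k ∈ t, ‖(fwdDiff (n : ℤ))^[m] (fun k : ℤ => f (h * k)) k‖ ≤
      2 ^ m * (A * h ^ (θ - 1) * (2 * ((1 + 1 / θ) * (((R + m) * n : ℕ) : ℝ) ^ θ))) := by
  refine sum_norm_fwdDiff_iter_le _ m n t fun i hi => ?_
  refine (Finset.sum_map t (addRightEmbedding (i * n : ℤ))
    fun k : ℤ => ‖f (h * k)‖).symm.trans_le ?_
  refine hf.sum_norm_le hf0 hθ hh (Finset.forall_mem_map.2 fun k hk => ?_)
  calc |k + i * n|
      ≤ |k| + |(i * n : ℤ)| := abs_add_le _ _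
    _ ≤ R * n + m * n := by
        rw [abs_of_nonneg (by positivity : (0 : ℤ) ≤ i * n)]
        gcongr
        exact ht k hk
    _ = ((R + m) * n : ℕ) := by push_cast; ring

theorem norm_fwdDiff_le (hf : HasSymbolBound m (θ - 1) A f) (hθ : θ < m) (hh : 0 < h) {n : ℕ}
    {k : ℤ} (hk : ((m + 1) * n : ℕ) < |k|) :
    ‖(fwdDiff (n : ℤ))^[m] (fun k : ℤ => f (h * k)) k‖ ≤
      A * (h * |(k : ℝ)| / (m + 1)) ^ (θ - 1 - m) * (h * n) ^ m := by
  have hk' : (m + 1) * n < |(k : ℝ)| := by exact_mod_cast hk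
  have hk0 : 0 < |(k : ℝ)| := lt_of_le_of_lt (by positivity) hk'
  have hfar : ∀ u ∈ Set.Icc (h * k) (h * k + m * (h * n)), h * |(k : ℝ)| / (m + 1) ≤ |u| := by
    intro u hu
    have htri : h * |(k : ℝ)| - m * (h * n) ≤ |u| := by
      rw [← abs_of_pos hh, ← abs_mul, abs_of_pos hh]
      have h1 := abs_sub_abs_le_abs_sub (h * k) u
      have h2 : |h * k - u| ≤ m * (h * n) := abs_le.2 ⟨by linarith [hu.2],
        by linarith [hu.1, (by positivity : 0 ≤ m * (h * n))]⟩
      linarith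
    rw [div_le_iff₀ (by positivity)]
    nlinarith [mul_le_mul_of_nonneg_left hk'.le (mul_nonneg hh.le m.cast_nonneg)]
  have hpos : 0 < h * |(k : ℝ)| / (m + 1) := by positivity
  have hne : ∀ u ∈ Set.Icc (h * k) (h * k + m * (h * n)), u ≠ 0 := fun u hu =>
    abs_pos.1 (hpos.trans_le (hfar u hu))
  have hdilate : (fwdDiff (n : ℤ))^[m] (fun k : ℤ => f (h * k)) k =
      (fwdDiff (h * n))^[m] f (h * k) := by
    simp only [fwdDiff_iter_eq_sum_shift]
    refine Finset.sum_congr rfl fun i _ => ?_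
    congr 2
    push_cast [nsmul_eq_mul]
    ring
  rw [hdilate]
  refine norm_fwdDiff_iter_le (by positivity) (fun u hu => hf.contDiffAt u (hne u hu))
    fun u hu => (hf.norm_iteratedDeriv_le m le_rfl u (hne u hu)).trans ?_
  exact mul_le_mul_of_nonneg_left
    (Real.rpow_le_rpow_of_nonpos hpos (hfar u hu) (by linarith)) hf.nonneg

theorem sum_norm_fwdDiff_le_of_lt_abs (hf : HasSymbolBound m (θ - 1) A f) (hθ : θ < m)
    (hh : 0 < h) {n : ℕ} (hn : 0 < n) {t : Finset ℤ} (ht : ∀ k ∈ t, ((m + 1) * n : ℕ) < |k|) :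
    ∑ k ∈ t, ‖(fwdDiff (n : ℤ))^[m] (fun k : ℤ => f (h * k)) k‖ ≤
      2 * (m + 1) * A / (m - θ) * (h ^ (θ - 1) * (n : ℝ) ^ θ) := by
  have hA := hf.nonneg
  have hmθ : 0 < m - θ := sub_pos.2 hθ
  calc ∑ k ∈ t, ‖(fwdDiff (n : ℤ))^[m] (fun k : ℤ => f (h * k)) k‖
      ≤ ∑ k ∈ t, A * (h / (m + 1)) ^ (θ - 1 - m) * (h * n) ^ m * |(k : ℝ)| ^ (-(m - θ) - 1) :=
        Finset.sum_le_sum fun k hk => (hf.norm_fwdDiff_le hθ hh (ht k hk)).trans_eq (by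
          rw [mul_div_right_comm, Real.mul_rpow (by positivity) (abs_nonneg _),
            show θ - 1 - m = -(m - θ) - 1 by ring]
          ring)
    _ ≤ A * (h / (m + 1)) ^ (θ - 1 - m) * (h * n) ^ m *
          (2 * ((((m + 1) * n : ℕ) : ℝ) ^ (-(m - θ)) / (m - θ))) := by
        rw [← Finset.mul_sum]
        gcongr
        exact sum_abs_rpow_neg_sub_one_le hmθ (by positivity) ht
    _ = 2 * (m + 1) * A / (m - θ) * (h ^ (θ - 1) * (n : ℝ) ^ θ) := by
        have hn' : (0 : ℝ) < n := Nat.cast_pos.2 hn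
        have hm : (0 : ℝ) < m + 1 := by positivity
        push_cast
        rw [Real.div_rpow hh.le hm.le, Real.mul_rpow hm.le hn'.le, neg_sub,
          Real.rpow_sub_natCast hh.ne', Real.rpow_sub_natCast hn'.ne', sub_right_comm θ 1 (m : ℝ),
          Real.rpow_sub_one hm.ne', mul_pow]
        field_simp

theorem exists_sum_norm_fwdDiff_le (hf : HasSymbolBound m (θ - 1) A f) (hf0 : f 0 = 0)
    (hθ : 0 < θ) (hθm : θ < m) : ∃ C : ℝ, ∀ h : ℝ, 0 < h → ∀ n : ℕ, 0 < n → ∀ t : Finset ℤ,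
      ∑ k ∈ t, ‖(fwdDiff (n : ℤ))^[m] (fun k : ℤ => f (h * k)) k‖ ≤
        C * (h ^ (θ - 1) * (n : ℝ) ^ θ) := by
  refine ⟨2 ^ m * (A * (2 * ((1 + 1 / θ) * ((m + 1 + m : ℕ) : ℝ) ^ θ))) +
    2 * (m + 1) * A / (m - θ), fun h hh n hn t => ?_⟩
  rw [← Finset.sum_filter_add_sum_filter_not t (fun k => |k| ≤ (((m + 1) * n : ℕ) : ℤ)),
    add_mul (2 ^ m * _)]
  refine add_le_add
    ((hf.sum_norm_fwdDiff_le_of_abs_le hf0 hθ hh (R := m + 1) fun k hk => ?_).trans_eq ?_)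
    (hf.sum_norm_fwdDiff_le_of_lt_abs hθm hh hn fun k hk => ?_)
  · exact_mod_cast (Finset.mem_filter.1 hk).2
  · rw [Nat.cast_mul, Real.mul_rpow (Nat.cast_nonneg _) n.cast_nonneg]
    ring
  · exact not_le.1 (Finset.mem_filter.1 hk).2

end HasSymbolBound

end SymbolBounds

section FourierCoefficients

variable {L : ℝ} {f g : ℝ → ℂ}

theorem norm_fourier_apply (k : ℤ) (z : AddCircle L) : ‖fourier k z‖ = 1 := Circle.norm_coe _

theorem fourier_apply_add (k : ℤ) (z w : AddCircle L) :
    fourier k (z + w) = fourier k z * fourier k w := by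
  rw [fourier_apply, smul_add, AddCircle.toCircle_add, Circle.coe_mul, ← fourier_apply,
    ← fourier_apply]

theorem fourier_apply_neg (k : ℤ) (z : AddCircle L) : fourier k (-z) = fourier (-k) z := by
  rw [fourier_apply, fourier_apply, smul_neg, neg_smul]

theorem contDiff_fourier_coe (L : ℝ) (k : ℤ) (n : WithTop ℕ∞) :
    ContDiff ℝ n fun x : ℝ => fourier k (x : AddCircle L) := by
  simp only [fourier_coe_apply]
  exact ((contDiff_const.mul Complex.ofRealCLM.contDiff).div_const _).cexp

theorem continuous_fourier_coe (L : ℝ) (k : ℤ) :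
    Continuous fun x : ℝ => fourier k (x : AddCircle L) :=
  (contDiff_fourier_coe L k 0).continuous

theorem fourierCoeffOn_eq_inv_mul_integral (hL : 0 < L) (f : ℝ → ℂ) (k : ℤ) :
    fourierCoeffOn hL f k = (L : ℂ)⁻¹ * ∫ x in 0..L, fourier (-k) (x : AddCircle L) * f x := by
  rw [fourierCoeffOn_eq_integral, sub_zero, one_div, Complex.real_smul, Complex.ofReal_inv]
  simp only [smul_eq_mul]

theorem fourierCoeffOn_add (hL : 0 < L) (hf : IntervalIntegrable f volume 0 L)
    (hg : IntervalIntegrable g volume 0 L) (k : ℤ) :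
    fourierCoeffOn hL (fun x => f x + g x) k = fourierCoeffOn hL f k + fourierCoeffOn hL g k := by
  have hc := (continuous_fourier_coe L (-k)).continuousOn (s := Set.uIcc 0 L)
  simp only [fourierCoeffOn_eq_inv_mul_integral, mul_add]
  rw [intervalIntegral.integral_add (hf.continuousOn_mul hc) (hg.continuousOn_mul hc), mul_add]

theorem fourierCoeffOn_sub (hL : 0 < L) (hf : IntervalIntegrable f volume 0 L)
    (hg : IntervalIntegrable g volume 0 L) (k : ℤ) :
    fourierCoeffOn hL (fun x => f x - g x) k = fourierCoeffOn hL f k - fourierCoeffOn hL g k := by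
  have hc := (continuous_fourier_coe L (-k)).continuousOn (s := Set.uIcc 0 L)
  simp only [fourierCoeffOn_eq_inv_mul_integral, mul_sub]
  rw [intervalIntegral.integral_sub (hf.continuousOn_mul hc) (hg.continuousOn_mul hc), mul_sub]

theorem fourierCoeffOn_fourier_mul (hL : 0 < L) (f : ℝ → ℂ) (j k : ℤ) :
    fourierCoeffOn hL (fun x => fourier j (x : AddCircle L) * f x) k =
      fourierCoeffOn hL f (k - j) := by
  simp only [fourierCoeffOn_eq_inv_mul_integral, ← mul_assoc, ← fourier_add]
  rw [show -k + j = -(k - j) by ring]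

theorem fourierCoeffOn_fourier_sub_one_pow_mul (hL : 0 < L) (hf : IntervalIntegrable f volume 0 L)
    (n : ℤ) (m : ℕ) (k : ℤ) :
    fourierCoeffOn hL (fun x => (fourier (-n) (x : AddCircle L) - 1) ^ m * f x) k =
      (fwdDiff n)^[m] (fourierCoeffOn hL f) k := by
  induction m generalizing f k with
  | zero => simp
  | succ m ih =>
    have hc := continuous_fourier_coe L (-n)
    have hstep : fourierCoeffOn hL (fun x => (fourier (-n) (x : AddCircle L) - 1) * f x) =
        fwdDiff n (fourierCoeffOn hL f) := funext fun k => by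
      simp only [sub_mul, one_mul]
      rw [fourierCoeffOn_sub hL (hf.continuousOn_mul hc.continuousOn) hf,
        fourierCoeffOn_fourier_mul, sub_neg_eq_add, fwdDiff]
    have hint : IntervalIntegrable (fun x => (fourier (-n) (x : AddCircle L) - 1) * f x)
        volume 0 L :=
      hf.continuousOn_mul (hc.sub continuous_const).continuousOn
    rw [Function.iterate_succ_apply, ← hstep, ← ih hint]
    simp only [pow_succ, mul_assoc]

theorem fourierCoeffOn_fourier (hL : 0 < L) (j k : ℤ) :
    fourierCoeffOn hL (fun x => fourier j (x : AddCircle L)) k = if k = j then 1 else 0 := by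
  have : Fact (0 < L) := ⟨hL⟩
  rw [fourierCoeffOn_eq_inv_mul_integral, ← Pi.single_apply j (1 : ℂ) k,
    ← fourierCoeff_fourier (T := L), fourierCoeff_eq_intervalIntegral _ _ 0, zero_add, one_div,
    Complex.real_smul, Complex.ofReal_inv]
  simp only [smul_eq_mul]

theorem fourierCoeffOn_sum_fourier (hL : 0 < L) (s : Finset ℤ) (u : ℤ → ℂ) (k : ℤ) :
    fourierCoeffOn hL (fun x => ∑ j ∈ s, u j * fourier j (x : AddCircle L)) k =
      if k ∈ s then u k else 0 := by
  have hcont (j : ℤ) : Continuous fun x : ℝ => u j * fourier j (x : AddCircle L) :=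
    continuous_const.mul (continuous_fourier_coe L j)
  have hsum : fourierCoeffOn hL (fun x => ∑ j ∈ s, u j * fourier j (x : AddCircle L)) k =
      ∑ j ∈ s, u j * fourierCoeffOn hL (fun x => fourier j (x : AddCircle L)) k := by
    induction s using Finset.induction_on with
    | empty => simp [fourierCoeffOn_eq_inv_mul_integral]
    | insert a s ha ih =>
      simp only [Finset.sum_insert ha]
      rw [fourierCoeffOn_add hL ((hcont a).intervalIntegrable 0 L)
        ((continuous_finsetSum s fun j _ => hcont j).intervalIntegrable 0 L), ih,
        fourierCoeffOn.const_mul]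
  rw [hsum]
  simp only [fourierCoeffOn_fourier, mul_ite, mul_one, mul_zero, Finset.sum_ite_eq]

theorem ae_norm_le_of_sum_norm_fourierCoeff_le [Fact (0 < L)] {f : AddCircle L → ℂ} {B : ℝ}
    (hf : MemLp f 2 AddCircle.haarAddCircle)
    (hB : ∀ s : Finset ℤ, ∑ k ∈ s, ‖fourierCoeff f k‖ ≤ B) :
    ∀ᵐ z ∂AddCircle.haarAddCircle, ‖f z‖ ≤ B := by
  let u : ℤ → C(AddCircle L, ℂ) := fun k => fourierCoeff f k • fourier k
  have hu (k : ℤ) : ‖u k‖ = ‖fourierCoeff f k‖ := by simp only [u, norm_smul, fourier_norm, mul_one]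
  have hsu : Summable fun k => ‖u k‖ := by
    simpa only [hu] using summable_of_sum_le (fun k => norm_nonneg _) hB
  have hsum := hasSum_fourier_series_L2 hf.toLp
  simp only [fourierCoeff_congr_ae hf.coeFn_toLp] at hsum
  have heq : hf.toLp = ContinuousMap.toLp (E := ℂ) 2 AddCircle.haarAddCircle ℂ (∑' k, u k) := by
    refine hsum.unique ?_
    convert! (ContinuousMap.toLp (E := ℂ) 2 (AddCircle.haarAddCircle (T := L)) ℂ).hasSum
      hsu.of_norm.hasSum using 1
  filter_upwards [heq ▸ hf.coeFn_toLp, ContinuousMap.coeFn_toLp (p := 2) (𝕜 := ℂ)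
    (AddCircle.haarAddCircle (T := L)) (∑' k, u k)] with z hz hzu
  rw [← hz, hzu]
  calc ‖(∑' k, u k) z‖ ≤ ∑' k, ‖u k‖ :=
        ((∑' k, u k).norm_coe_le_norm z).trans (norm_tsum_le_tsum_norm hsu)
    _ ≤ B := hsu.tsum_le_of_sum_le fun s => by simpa only [hu] using hB s

theorem ae_norm_le_of_sum_norm_fourierCoeffOn_le (hL : 0 < L)
    (hf : MemLp f 2 (volume.restrict (Set.Ioc 0 L))) {B : ℝ}
    (hB : ∀ s : Finset ℤ, ∑ k ∈ s, ‖fourierCoeffOn hL f k‖ ≤ B) :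
    ∀ᵐ x ∂volume.restrict (Set.Ioc 0 L), ‖f x‖ ≤ B := by
  have : Fact (0 < L - 0) := ⟨by simpa using hL⟩
  have hlift : MemLp (AddCircle.liftIoc (L - 0) 0 f) 2 AddCircle.haarAddCircle :=
    (MemLp.memLp_liftIoc (by simpa using hf)).haarAddCircle
  have hvol : ∀ᵐ z ∂(volume : Measure (AddCircle (L - 0))),
      ‖AddCircle.liftIoc (L - 0) 0 f z‖ ≤ B := by
    rw [AddCircle.volume_eq_smul_haarAddCircle]
    exact Measure.ae_smul_measure (ae_norm_le_of_sum_norm_fourierCoeff_le hlift hB) _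
  have hpull := (AddCircle.measurePreserving_mk (L - 0) 0).quasiMeasurePreserving.ae hvol
  rw [show Set.Ioc 0 (0 + (L - 0)) = Set.Ioc 0 L by simp] at hpull
  filter_upwards [hpull, ae_restrict_mem measurableSet_Ioc] with x hx hxm
  rwa [AddCircle.liftIoc_coe_apply (by simpa using hxm)] at hx

theorem exists_one_le_norm_fourier_sub_one_of_le_half {d : ℝ} (hd : 0 < d) (hdL : d ≤ L / 2) :
    ∃ n : ℕ, 0 < n ∧ n * d ≤ L ∧ 1 ≤ ‖fourier (-n : ℤ) (d : AddCircle L) - 1‖ := by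
  have hL : 0 < L := by linarith
  have hone : 1 ≤ L / (2 * d) := (one_le_div (by positivity)).2 (by linarith)
  have hfloor_le : (⌊L / (2 * d)⌋₊ : ℝ) * (2 * d) ≤ L :=
    (le_div_iff₀ (by positivity)).1 (Nat.floor_le (by positivity))
  have hlt_floor : L < (⌊L / (2 * d)⌋₊ + 1 : ℝ) * (2 * d) :=
    (div_lt_iff₀ (by positivity)).1 (Nat.lt_floor_add_one _)
  have hfloor_pos : 0 < ⌊L / (2 * d)⌋₊ := Nat.floor_pos.2 hone
  generalize ⌊L / (2 * d)⌋₊ = n at *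
  have hn : (1 : ℝ) ≤ n := Nat.one_le_cast.2 hfloor_pos
  refine ⟨n, hfloor_pos, by linarith [mul_pos (one_pos.trans_le hn) hd], ?_⟩
  have harg : fourier (-n : ℤ) (d : AddCircle L) =
      Complex.exp (Complex.I * ((-(2 * (Real.pi * (n * d / L))) : ℝ) : ℂ)) := by
    rw [fourier_coe_apply]
    push_cast
    ring_nf
  have hquarter : 1 ≤ 4 * (n * d / L) := by
    rw [← mul_div_assoc, one_le_div hL]
    nlinarith
  have hhalf : n * d / L ≤ 1 / 2 := (div_le_iff₀ hL).2 (by linarith)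
  have hsin := Real.mul_le_sin (x := Real.pi * (n * d / L)) (by positivity)
    (by nlinarith [Real.pi_pos])
  rw [← mul_assoc, div_mul_cancel₀ _ Real.pi_ne_zero] at hsin
  rw [harg, Complex.norm_exp_I_mul_ofReal_sub_one, neg_div, mul_div_cancel_left₀ _ two_ne_zero,
    Real.sin_neg, mul_neg, norm_neg, Real.norm_eq_abs]
  exact le_abs.2 (Or.inl (by linarith))

theorem exists_one_le_norm_fourier_sub_one {x : ℝ} (hx : x ∈ Set.Ioo 0 L) :
    ∃ n : ℕ, 0 < n ∧ n * min x (L - x) ≤ L ∧ 1 ≤ ‖fourier (-n : ℤ) (x : AddCircle L) - 1‖ := by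
  obtain ⟨hx0, hxL⟩ := hx
  rcases le_total x (L - x) with h | h
  · rw [min_eq_left h]
    exact exists_one_le_norm_fourier_sub_one_of_le_half hx0 (by linarith)
  · rw [min_eq_right h]
    obtain ⟨n, hn, hnL, hle⟩ := exists_one_le_norm_fourier_sub_one_of_le_half (L := L)
      (d := L - x) (by linarith) (by linarith)
    refine ⟨n, hn, hnL, hle.trans_eq ?_⟩
    rw [AddCircle.coe_sub, AddCircle.coe_period, zero_sub, fourier_apply_neg, fourier_neg,
      ← RCLike.norm_conj, map_sub, map_one, Complex.conj_conj]

theorem ae_norm_le_of_sum_norm_fwdDiff_fourierCoeffOn_le (hL : 0 < L)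
    (hf : MemLp f 2 (volume.restrict (Set.Ioc 0 L))) {m : ℕ} {θ B : ℝ} (hθ : 0 ≤ θ)
    (hB : ∀ n : ℕ, 0 < n → ∀ s : Finset ℤ,
      ∑ k ∈ s, ‖(fwdDiff (n : ℤ))^[m] (fourierCoeffOn hL f) k‖ ≤ B * (n : ℝ) ^ θ) :
    ∀ᵐ x ∂volume.restrict (Set.Ioc 0 L), ‖f x‖ ≤ B * (L / min x (L - x)) ^ θ := by
  have hB0 : 0 ≤ B := by simpa using hB 1 one_pos ∅
  have hfi : IntervalIntegrable f volume 0 L :=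
    (intervalIntegrable_iff_integrableOn_Ioc_of_le hL.le).2 (hf.integrable (by norm_num))
  have hbound : ∀ᵐ x : ℝ ∂volume.restrict (Set.Ioc 0 L), ∀ n : ℕ, 0 < n →
      ‖(fourier (-n : ℤ) (x : AddCircle L) - 1) ^ m * f x‖ ≤ B * (n : ℝ) ^ θ := by
    refine ae_all_iff.2 fun n => eventually_imp_distrib_left.2 fun hn => ?_
    have hmem : MemLp (fun x : ℝ => (fourier (-n : ℤ) (x : AddCircle L) - 1) ^ m * f x) 2
        (volume.restrict (Set.Ioc 0 L)) := by
      have hc : Continuous fun x : ℝ => (fourier (-n : ℤ) (x : AddCircle L) - 1) ^ m :=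
        ((continuous_fourier_coe L _).sub continuous_const).pow m
      refine hf.of_le_mul (c := 2 ^ m) (hc.aestronglyMeasurable.mul hf.1) (ae_of_all _ fun x => ?_)
      rw [norm_mul, norm_pow]
      gcongr
      exact (norm_sub_le _ _).trans_eq (by rw [norm_fourier_apply, norm_one]; norm_num)
    refine ae_norm_le_of_sum_norm_fourierCoeffOn_le hL hmem fun s => ?_
    simpa only [fourierCoeffOn_fourier_sub_one_pow_mul hL hfi] using hB n hn s
  rw [← Measure.restrict_congr_set Ioo_ae_eq_Ioc] at hbound ⊢
  filter_upwards [hbound, ae_restrict_mem measurableSet_Ioo] with x hx hxm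
  obtain ⟨n, hn, hnL, hone⟩ := exists_one_le_norm_fourier_sub_one hxm
  have hmin : 0 < min x (L - x) := lt_min hxm.1 (sub_pos.2 hxm.2)
  calc ‖f x‖ ≤ ‖(fourier (-n : ℤ) (x : AddCircle L) - 1) ^ m * f x‖ := by
        rw [norm_mul, norm_pow]
        exact le_mul_of_one_le_left (norm_nonneg _) (one_le_pow₀ hone)
    _ ≤ B * (n : ℝ) ^ θ := hx n hn
    _ ≤ B * (L / min x (L - x)) ^ θ := by
        gcongr
        exact (le_div_iff₀ hmin).2 hnL

end FourierCoefficients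

section Reconstruction

variable {L : ℝ} {f g : ℝ → ℂ} {σ : ℝ → ℝ} {Ω : ℝ}

/-- The convolution kernel of the filtered reconstruction: the filtered Fourier series of the
periodic unit mass at `0`, multiplied by `L`. -/
noncomputable def filterKernel (L : ℝ) (σ : ℝ → ℝ) (Ω x : ℝ) : ℂ :=
  ∑ k ∈ Finset.Icc (-⌊L * Ω / (2 * Real.pi)⌋) ⌊L * Ω / (2 * Real.pi)⌋,
    σ (2 * Real.pi / (L * Ω) * k) * fourier k (x : AddCircle L)

theorem continuous_filterKernel (L : ℝ) (σ : ℝ → ℝ) (Ω : ℝ) : Continuous (filterKernel L σ Ω) :=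
  continuous_finsetSum _ fun k _ => continuous_const.mul (continuous_fourier_coe L k)

theorem filteredReconstruction_eq_sum (hL : 0 < L) (f : ℝ → ℂ) (σ : ℝ → ℝ) (Ω : ℝ) :
    filteredReconstruction hL f σ Ω = fun x : ℝ =>
      ∑ k ∈ Finset.Icc (-⌊L * Ω / (2 * Real.pi)⌋) ⌊L * Ω / (2 * Real.pi)⌋,
        fourierCoeffOn hL f k * σ (2 * Real.pi / (L * Ω) * k) * fourier k (x : AddCircle L) := by
  ext x
  refine Finset.sum_congr rfl fun k _ => ?_
  rw [fourier_coe_apply, show 2 * Real.pi * k / L / Ω = 2 * Real.pi / (L * Ω) * k by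
    rw [div_div]; ring]
  push_cast
  ring_nf

theorem filteredReconstruction_eq_integral (hL : 0 < L) (hf : IntervalIntegrable f volume 0 L)
    (σ : ℝ → ℝ) (Ω x : ℝ) :
    filteredReconstruction hL f σ Ω x =
      (L : ℂ)⁻¹ * ∫ y in 0..L, f y * filterKernel L σ Ω (x - y) := by
  have hint (k : ℤ) : IntervalIntegrable (fun y : ℝ => fourier (-k) (y : AddCircle L) * f y)
      volume 0 L := hf.continuousOn_mul (continuous_fourier_coe L _).continuousOn
  simp only [filteredReconstruction_eq_sum, fourierCoeffOn_eq_inv_mul_integral, mul_assoc,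
    ← Finset.mul_sum, ← intervalIntegral.integral_mul_const]
  rw [← intervalIntegral.integral_finsetSum fun k _ => by
    simpa only [mul_assoc] using (hint k).mul_const _]
  congr 2 with y
  rw [filterKernel, Finset.mul_sum]
  refine Finset.sum_congr rfl fun k _ => ?_
  rw [sub_eq_add_neg, AddCircle.coe_add, fourier_apply_add, AddCircle.coe_neg, fourier_apply_neg]
  ring

theorem continuous_filteredReconstruction (hL : 0 < L) (f : ℝ → ℂ) (σ : ℝ → ℝ) (Ω : ℝ) :
    Continuous (filteredReconstruction hL f σ Ω) := by
  rw [filteredReconstruction_eq_sum]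
  exact continuous_finsetSum _ fun k _ => continuous_const.mul (continuous_fourier_coe L k)

theorem periodic_filteredReconstruction (hL : 0 < L) (f : ℝ → ℂ) (σ : ℝ → ℝ) (Ω : ℝ) :
    Function.Periodic (filteredReconstruction hL f σ Ω) L := fun x => by
  simp only [filteredReconstruction_eq_sum, AddCircle.coe_add_period]

theorem filteredReconstruction_add (hL : 0 < L) (hf : IntervalIntegrable f volume 0 L)
    (hg : IntervalIntegrable g volume 0 L) (σ : ℝ → ℝ) (Ω x : ℝ) :
    filteredReconstruction hL (fun x => f x + g x) σ Ω x =
      filteredReconstruction hL f σ Ω x + filteredReconstruction hL g σ Ω x := by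
  simp only [filteredReconstruction, ← Finset.sum_add_distrib, fourierCoeffOn_add hL hf hg, add_mul]

theorem filteredReconstruction_congr_ae (hL : 0 < L)
    (h : f =ᵐ[volume.restrict (Set.Ioc 0 L)] g) (σ : ℝ → ℝ) (Ω : ℝ) :
    filteredReconstruction hL f σ Ω = filteredReconstruction hL g σ Ω := by
  ext x
  simp only [filteredReconstruction, fourierCoeffOn_congr_ae hL h]

theorem fourierCoeffOn_filteredReconstruction (hL : 0 < L) (f : ℝ → ℂ)
    (hσ : ∀ η : ℝ, 1 ≤ |η| → σ η = 0) (hΩ : 0 < Ω) (k : ℤ) :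
    fourierCoeffOn hL (filteredReconstruction hL f σ Ω) k =
      fourierCoeffOn hL f k * σ (2 * Real.pi / (L * Ω) * k) := by
  rw [filteredReconstruction_eq_sum, fourierCoeffOn_sum_fourier, ite_eq_left_iff]
  intro hk
  rw [hσ, Complex.ofReal_zero, mul_zero]
  rw [Finset.mem_Icc, ← abs_le, not_le, Int.floor_lt, Int.cast_abs] at hk
  have hpi := Real.pi_pos
  rw [abs_mul, abs_of_pos (by positivity)]
  calc 1 = 2 * Real.pi / (L * Ω) * (L * Ω / (2 * Real.pi)) := by field_simp
    _ ≤ _ := by gcongr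

end Reconstruction

section Sawtooth

variable {L : ℝ}

/-- The `L`-periodic sawtooth wave, equal to `L / 2 - x` on `[0, L)`: up to translations, the jump
discontinuity out of which all piecewise smooth functions are built. -/
noncomputable def sawtooth (L x : ℝ) : ℂ := ((L / 2 - L * Int.fract (x / L) : ℝ) : ℂ)

theorem sawtooth_of_mem_Ico {x : ℝ} (hx : x ∈ Set.Ico 0 L) : sawtooth L x = L / 2 - x := by
  have hL : 0 < L := hx.1.trans_lt hx.2
  rw [sawtooth, Int.fract_eq_self.2 ⟨div_nonneg hx.1 hL.le, (div_lt_one hL).2 hx.2⟩,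
    mul_div_cancel₀ _ hL.ne']
  push_cast
  rfl

theorem periodic_sawtooth (hL : L ≠ 0) : Function.Periodic (sawtooth L) L := fun x => by
  rw [sawtooth, sawtooth, add_div, div_self hL, Int.fract_add_one]

theorem sawtooth_of_mem_Ico_neg {x : ℝ} (hx : x ∈ Set.Ico (-L) 0) :
    sawtooth L x = -(L / 2) - x := by
  have hL : 0 < L := by linarith [hx.1, hx.2]
  rw [← periodic_sawtooth hL.ne' x, sawtooth_of_mem_Ico ⟨by linarith [hx.1], by linarith [hx.2]⟩]
  push_cast
  ring

theorem norm_sawtooth_le (hL : 0 ≤ L) (x : ℝ) : ‖sawtooth L x‖ ≤ L := by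
  rw [sawtooth, Complex.norm_real, Real.norm_eq_abs, abs_le]
  have h₀ := Int.fract_nonneg (x / L)
  have h₁ := (Int.fract_lt_one (x / L)).le
  constructor <;> nlinarith

theorem measurable_sawtooth (L : ℝ) : Measurable (sawtooth L) := by
  unfold sawtooth
  fun_prop

theorem memLp_sawtooth (hL : 0 ≤ L) (p : ENNReal) (μ : Measure ℝ) [IsFiniteMeasure μ] :
    MemLp (sawtooth L) p μ :=
  .of_bound (measurable_sawtooth L).aestronglyMeasurable L (ae_of_all _ (norm_sawtooth_le hL))

-- At `k = 0` the right-hand side is `0` because Lean divides by zero there.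
theorem fourierCoeffOn_sawtooth (hL : 0 < L) (k : ℤ) :
    fourierCoeffOn hL (sawtooth L) k = L / (2 * Real.pi * Complex.I * k) := by
  have hcongr : fourierCoeffOn hL (sawtooth L) k =
      fourierCoeffOn hL (fun x : ℝ => (L / 2 - x : ℂ)) k := by
    rw [fourierCoeffOn_eq_inv_mul_integral, fourierCoeffOn_eq_inv_mul_integral]
    congr 1
    exact intervalIntegral.integral_congr_Ioo_of_le hL.le fun x hx => by
      simp only [sawtooth_of_mem_Ico (Set.Ioo_subset_Ico_self hx)]
  have hderiv (x : ℝ) : HasDerivAt (fun x : ℝ => (L / 2 - x : ℂ)) (-1) x :=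
    Complex.ofRealCLM.hasDerivAt.const_sub _
  rw [hcongr]
  rcases eq_or_ne k 0 with rfl | hk
  · have hint : ∫ x : ℝ in 0..L, (L / 2 - x : ℂ) = 0 := by
      rw [intervalIntegral.integral_sub intervalIntegrable_const
        (Complex.continuous_ofReal.intervalIntegrable 0 L), intervalIntegral.integral_ofReal,
        integral_id, intervalIntegral.integral_const, sub_zero, Complex.real_smul]
      push_cast
      ring
    simp [fourierCoeffOn_eq_inv_mul_integral, hint]
  · have hone : fourierCoeffOn hL (fun _ => (-1 : ℂ)) k = 0 := by
      have hfourier := fourierCoeffOn_fourier hL 0 k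
      simp only [fourier_zero, if_neg hk] at hfourier
      have hmul := fourierCoeffOn.const_mul (fun _ => 1) (-1) k hL
      simpa only [hfourier, mul_one, mul_zero] using hmul
    rw [fourierCoeffOn_of_hasDerivAt hL hk (fun x _ => hderiv x) intervalIntegrable_const, hone]
    have hkc : (k : ℂ) ≠ 0 := Int.cast_ne_zero.2 hk
    have hpi : (Real.pi : ℂ) ≠ 0 := Complex.ofReal_ne_zero.2 Real.pi_ne_zero
    rw [AddCircle.coe_zero, fourier_eval_zero, Complex.ofReal_zero]
    field_simp [Complex.I_ne_zero]
    ring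

/-- The error of the filtered reconstruction of the sawtooth wave. -/
noncomputable def sawtoothError (hL : 0 < L) (σ : ℝ → ℝ) (Ω x : ℝ) : ℂ :=
  sawtooth L x - filteredReconstruction hL (sawtooth L) σ Ω x

variable {σ : ℝ → ℝ} {Ω : ℝ}

theorem periodic_sawtoothError (hL : 0 < L) (σ : ℝ → ℝ) (Ω : ℝ) :
    Function.Periodic (sawtoothError hL σ Ω) L :=
  (periodic_sawtooth hL.ne').sub (periodic_filteredReconstruction hL _ σ Ω)

theorem measurable_sawtoothError (hL : 0 < L) (σ : ℝ → ℝ) (Ω : ℝ) :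
    Measurable (sawtoothError hL σ Ω) :=
  (measurable_sawtooth L).sub (continuous_filteredReconstruction hL _ σ Ω).measurable

theorem memLp_restrict_Ioc_of_continuous {E : Type*} [NormedAddCommGroup E]
    [SecondCountableTopology E] {f : ℝ → E} (hf : Continuous f) (p : ENNReal) (a b : ℝ) :
    MemLp f p (volume.restrict (Set.Ioc a b)) := by
  obtain ⟨C, hC⟩ := isCompact_Icc.exists_bound_of_continuousOn (s := Set.Icc a b) hf.continuousOn
  exact .of_bound hf.aestronglyMeasurable C ((ae_restrict_mem measurableSet_Ioc).mono fun x hx =>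
    hC x (Set.Ioc_subset_Icc_self hx))

theorem memLp_sawtoothError (hL : 0 < L) (σ : ℝ → ℝ) (Ω : ℝ) (p : ENNReal) :
    MemLp (sawtoothError hL σ Ω) p (volume.restrict (Set.Ioc 0 L)) :=
  (memLp_sawtooth hL.le p _).sub
    (memLp_restrict_Ioc_of_continuous (continuous_filteredReconstruction hL _ σ Ω) p 0 L)

theorem fourierCoeffOn_sawtoothError (hL : 0 < L) (hσ : ∀ η : ℝ, 1 ≤ |η| → σ η = 0) (hΩ : 0 < Ω)
    (k : ℤ) : fourierCoeffOn hL (sawtoothError hL σ Ω) k =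
      errorSymbol σ (2 * Real.pi / (L * Ω) * k) • (1 / (Complex.I * Ω)) := by
  have hpi : (Real.pi : ℂ) ≠ 0 := Complex.ofReal_ne_zero.2 Real.pi_ne_zero
  have hΩc : (Ω : ℂ) ≠ 0 := Complex.ofReal_ne_zero.2 hΩ.ne'
  have hLc : (L : ℂ) ≠ 0 := Complex.ofReal_ne_zero.2 hL.ne'
  have hsaw : IntervalIntegrable (sawtooth L) volume 0 L :=
    (intervalIntegrable_iff_integrableOn_Ioc_of_le hL.le).2
      ((memLp_sawtooth hL.le 1 _).integrable le_rfl)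
  unfold sawtoothError
  rw [fourierCoeffOn_sub hL hsaw
    ((continuous_filteredReconstruction hL _ σ Ω).intervalIntegrable 0 L),
    fourierCoeffOn_filteredReconstruction hL _ hσ hΩ, fourierCoeffOn_sawtooth, errorSymbol,
    Complex.real_smul]
  rcases eq_or_ne k 0 with rfl | hk
  · simp
  · have hkc : (k : ℂ) ≠ 0 := Int.cast_ne_zero.2 hk
    push_cast
    field_simp

theorem fwdDiff_iter_smul_const {M R E : Type*} [AddCommMonoid M] [Ring R] [AddCommGroup E]
    [Module R E] (h : M) (f : M → R) (e : E) (n : ℕ) (x : M) :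
    (fwdDiff h)^[n] (fun y => f y • e) x = (fwdDiff h)^[n] f x • e := by
  simp only [fwdDiff_iter_eq_sum_shift, Finset.sum_smul, smul_assoc]

theorem IsSpectralFilter.exists_ae_norm_sawtoothError_le {q : ℕ} (hL : 0 < L)
    (hσ : IsSpectralFilter q σ) {θ : ℝ} (hθ : 0 < θ) (hθq : θ < (q - 1 : ℕ)) :
    ∃ C : ℝ, ∀ Ω : ℝ, 0 < Ω → ∀ᵐ x ∂volume.restrict (Set.Ioc 0 L),
      ‖sawtoothError hL σ Ω x‖ ≤ C * (Ω * min x (L - x)) ^ (-θ) := by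
  obtain ⟨A, hA⟩ := hσ.exists_hasSymbolBound_errorSymbol
  obtain ⟨C, hC⟩ := (hA θ ⟨hθ.le, hθq.le⟩).exists_sum_norm_fwdDiff_le (errorSymbol_zero σ) hθ hθq
  refine ⟨C * (2 * Real.pi) ^ (θ - 1) * L, fun Ω hΩ => ?_⟩
  have hpi := Real.pi_pos
  have hae := ae_norm_le_of_sum_norm_fwdDiff_fourierCoeffOn_le hL (memLp_sawtoothError hL σ Ω 2)
    (m := q - 1) hθ.le (B := C * (2 * Real.pi / (L * Ω)) ^ (θ - 1) / Ω) fun n hn s => by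
      have hsum := hC (2 * Real.pi / (L * Ω)) (by positivity) n hn s
      simp only [funext (fourierCoeffOn_sawtoothError hL hσ.eq_zero hΩ), fwdDiff_iter_smul_const,
        norm_smul, ← Finset.sum_mul]
      have hnorm : ‖(1 / (Complex.I * Ω) : ℂ)‖ = Ω⁻¹ := by simp [abs_of_pos hΩ]
      calc _ ≤ C * ((2 * Real.pi / (L * Ω)) ^ (θ - 1) * (n : ℝ) ^ θ) * Ω⁻¹ := by
            rw [hnorm]
            gcongr
        _ = C * (2 * Real.pi / (L * Ω)) ^ (θ - 1) / Ω * (n : ℝ) ^ θ := by ring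
  rw [← Measure.restrict_congr_set Ioo_ae_eq_Ioc] at hae ⊢
  filter_upwards [hae, ae_restrict_mem measurableSet_Ioo] with x hx hxm
  have hmin : 0 < min x (L - x) := lt_min hxm.1 (sub_pos.2 hxm.2)
  refine hx.trans_eq ?_
  rw [Real.div_rpow hL.le hmin.le, Real.div_rpow (by positivity) (by positivity),
    Real.mul_rpow hL.le hΩ.le, Real.rpow_neg (by positivity), Real.mul_rpow hΩ.le hmin.le,
    Real.rpow_sub_one hL.ne', Real.rpow_sub_one hΩ.ne']
  field_simp

theorem eLpNorm_comp_const_mul_left {E : Type*} [NormedAddCommGroup E] (f : ℝ → E) {a : ℝ}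
    (ha : 0 < a) {p : ℝ} (hp : 0 ≤ p) :
    eLpNorm (fun x => f (a * x)) (ENNReal.ofReal p) volume =
      ENNReal.ofReal (a ^ (-(1 / p))) * eLpNorm f (ENNReal.ofReal p) volume := by
  have hmap := (Homeomorph.mulLeft₀ a ha.ne').measurableEmbedding.eLpNorm_map_measure (g := f)
    (p := ENNReal.ofReal p) (μ := volume)
  rw [Homeomorph.coe_mulLeft₀, Real.map_volume_mul_left ha.ne',
    eLpNorm_smul_measure_of_ne_top ENNReal.ofReal_ne_top, abs_of_pos (inv_pos.2 ha),
    smul_eq_mul, ENNReal.toReal_div, ENNReal.toReal_ofReal hp, ENNReal.toReal_one,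
    ENNReal.ofReal_rpow_of_nonneg (inv_pos.2 ha).le (by positivity), Real.inv_rpow ha.le,
    ← Real.rpow_neg ha.le] at hmap
  exact hmap.symm

theorem integrableOn_Ioi_min_rpow {α β : ℝ} (hα : α < 1) (hβ : 1 < β) :
    IntegrableOn (fun t : ℝ => min (t ^ (-α)) (t ^ (-β))) (Set.Ioi 0) := by
  have hmeas : Measurable fun t : ℝ => min (t ^ (-α)) (t ^ (-β)) := by fun_prop
  have hnorm {t : ℝ} (ht : 0 < t) : ‖min (t ^ (-α)) (t ^ (-β))‖ = min (t ^ (-α)) (t ^ (-β)) :=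
    Real.norm_of_nonneg (by positivity)
  have hIoc : IntegrableOn (fun t : ℝ => t ^ (-α)) (Set.Ioc 0 1) :=
    (intervalIntegrable_iff_integrableOn_Ioc_of_le zero_le_one).1
      (intervalIntegral.intervalIntegrable_rpow' (by linarith))
  have hIoi : IntegrableOn (fun t : ℝ => t ^ (-β)) (Set.Ioi 1) :=
    integrableOn_Ioi_rpow_of_lt (by linarith) one_pos
  rw [← Set.Ioc_union_Ioi_eq_Ioi (zero_le_one' ℝ)]
  refine .union (hIoc.mono' hmeas.aestronglyMeasurable ?_)
    (hIoi.mono' hmeas.aestronglyMeasurable ?_)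
  · exact (ae_restrict_mem measurableSet_Ioc).mono fun t ht =>
      (hnorm ht.1).trans_le (min_le_left _ _)
  · exact (ae_restrict_mem measurableSet_Ioi).mono fun t ht =>
      (hnorm (one_pos.trans ht)).trans_le (min_le_right _ _)

theorem memLp_indicator_Ioi_min_rpow {α β p : ℝ} (hp : 0 < p) (hα : α * p < 1) (hβ : 1 < β * p) :
    MemLp ((Set.Ioi 0).indicator fun t : ℝ => min (t ^ (-α)) (t ^ (-β))) (ENNReal.ofReal p)
      volume := by
  rw [memLp_indicator_iff_restrict measurableSet_Ioi,
    ← integrable_norm_rpow_iff (by fun_prop) (by simpa using hp) ENNReal.ofReal_ne_top,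
    ENNReal.toReal_ofReal hp.le]
  refine (integrableOn_Ioi_min_rpow hα hβ).congr ((ae_restrict_mem measurableSet_Ioi).mono ?_)
  intro t ht
  have ht0 : 0 < t := ht
  beta_reduce
  rw [Real.norm_of_nonneg (by positivity),
    (Real.monotoneOn_rpow_Ici_of_exponent_nonneg hp.le).map_min (Set.mem_Ici.2 (by positivity))
      (Set.mem_Ici.2 (by positivity)), ← Real.rpow_mul ht0.le, ← Real.rpow_mul ht0.le, neg_mul,
    neg_mul]

theorem eLpNorm_comp_mul_add_comp_mul_sub_le {G : ℝ → ℝ} (hG : Measurable G) (L : ℝ) {Ω p : ℝ}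
    (hΩ : 0 < Ω) (hp : 1 ≤ p) :
    eLpNorm (fun x => G (Ω * x) + G (Ω * (L - x))) (ENNReal.ofReal p) volume ≤
      ENNReal.ofReal (2 * Ω ^ (-(1 / p))) * eLpNorm G (ENNReal.ofReal p) volume := by
  have hGΩ : Measurable fun x => G (Ω * x) := hG.comp (measurable_const_mul Ω)
  have hscale := eLpNorm_comp_const_mul_left G hΩ (zero_le_one.trans hp)
  have hreflect : eLpNorm ((fun x => G (Ω * x)) ∘ fun x => L - x) (ENNReal.ofReal p) volume =
      eLpNorm (fun x => G (Ω * x)) (ENNReal.ofReal p) volume :=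
    eLpNorm_comp_measurePreserving hGΩ.aestronglyMeasurable (volume.measurePreserving_sub_left L)
  refine (eLpNorm_add_le hGΩ.aestronglyMeasurable
    (hGΩ.comp (measurable_const_sub L)).aestronglyMeasurable
    (ENNReal.one_le_ofReal.2 hp)).trans_eq ?_
  rw [hreflect, hscale, ← two_mul, ENNReal.ofReal_mul zero_le_two, ENNReal.ofReal_ofNat, mul_assoc]

theorem exists_eLpNorm_le_of_ae_norm_le_min_rpow {α β p : ℝ} (hp : 1 ≤ p) (hα : α * p < 1)
    (hβ : 1 < β * p) :
    ∃ K : ℝ, ∀ (f : ℝ → ℂ) {C Ω : ℝ}, 0 ≤ C → 0 < Ω →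
      (∀ᵐ x ∂volume.restrict (Set.Ioc 0 L), ‖f x‖ ≤
        C * min ((Ω * min x (L - x)) ^ (-α)) ((Ω * min x (L - x)) ^ (-β))) →
      eLpNorm f (ENNReal.ofReal p) (volume.restrict (Set.Ioc 0 L)) ≤
        ENNReal.ofReal (C * K * Ω ^ (-(1 / p))) := by
  have hGp := memLp_indicator_Ioi_min_rpow (one_pos.trans_le hp) hα hβ
  set G : ℝ → ℝ := (Set.Ioi 0).indicator fun t => min (t ^ (-α)) (t ^ (-β))
  have hGm : Measurable G := Measurable.indicator (by fun_prop) measurableSet_Ioi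
  have hG0 (t : ℝ) : 0 ≤ G t := Set.indicator_nonneg (fun t (ht : 0 < t) => by positivity) t
  have hG {t : ℝ} (ht : 0 < t) : min (t ^ (-α)) (t ^ (-β)) = G t :=
    (Set.indicator_of_mem (f := fun t : ℝ => min (t ^ (-α)) (t ^ (-β))) (Set.mem_Ioi.2 ht)).symm
  clear_value G
  refine ⟨2 * (eLpNorm G (ENNReal.ofReal p) volume).toReal, fun f C Ω hC hΩ hf => ?_⟩
  have hle : ∀ᵐ x ∂volume.restrict (Set.Ioc 0 L),
      ‖f x‖ ≤ C * ‖G (Ω * x) + G (Ω * (L - x))‖ := by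
    rw [← Measure.restrict_congr_set Ioo_ae_eq_Ioc] at hf ⊢
    filter_upwards [hf, ae_restrict_mem measurableSet_Ioo] with x hx ⟨hx0, hxL⟩
    refine hx.trans ?_
    rw [Real.norm_of_nonneg (add_nonneg (hG0 _) (hG0 _)),
      hG (mul_pos hΩ (lt_min hx0 (sub_pos.2 hxL)))]
    gcongr
    rcases min_choice x (L - x) with h | h <;> rw [h]
    · exact le_add_of_nonneg_right (hG0 _)
    · exact le_add_of_nonneg_left (hG0 _)
  calc eLpNorm f (ENNReal.ofReal p) (volume.restrict (Set.Ioc 0 L))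
      ≤ ENNReal.ofReal C * eLpNorm (fun x => G (Ω * x) + G (Ω * (L - x))) (ENNReal.ofReal p)
          (volume.restrict (Set.Ioc 0 L)) := eLpNorm_le_mul_eLpNorm_of_ae_le_mul hle _
    _ ≤ ENNReal.ofReal C * (ENNReal.ofReal (2 * Ω ^ (-(1 / p))) *
          eLpNorm G (ENNReal.ofReal p) volume) := by
        gcongr
        exact (eLpNorm_mono_measure _ Measure.restrict_le_self).trans
          (eLpNorm_comp_mul_add_comp_mul_sub_le hGm L hΩ hp)
    _ = ENNReal.ofReal (C * (2 * (eLpNorm G (ENNReal.ofReal p) volume).toReal) *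
          Ω ^ (-(1 / p))) := by
        rw [← ENNReal.ofReal_toReal hGp.2.ne, ← ENNReal.ofReal_mul (by positivity),
          ← ENNReal.ofReal_mul hC, ENNReal.toReal_ofReal ENNReal.toReal_nonneg]
        ring_nf

theorem IsSpectralFilter.exists_eLpNorm_sawtoothError_le {q : ℕ} (hL : 0 < L)
    (hσ : IsSpectralFilter q σ) {p : ℝ} (hp : 1 ≤ p) (hpq : 1 < p * ((q : ℝ) - 1)) :
    ∃ C : ℝ, ∀ Ω : ℝ, 0 < Ω →
      eLpNorm (sawtoothError hL σ Ω) (ENNReal.ofReal p) (volume.restrict (Set.Ioc 0 L)) ≤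
        ENNReal.ofReal (C * Ω ^ (-(1 / p))) := by
  have hp0 : 0 < p := one_pos.trans_le hp
  have hq : 1 ≤ q := by
    rw [Nat.one_le_iff_ne_zero]
    rintro rfl
    norm_num at hpq
    linarith
  have hlt : 1 / p < (q - 1 : ℕ) := by
    rw [div_lt_iff₀' hp0]
    simpa [Nat.cast_sub hq] using hpq
  obtain ⟨α, hα0, hα⟩ := exists_between (one_div_pos.2 hp0)
  obtain ⟨β, hβ, hβq⟩ := exists_between hlt
  obtain ⟨A, hA⟩ := hσ.exists_ae_norm_sawtoothError_le hL hα0 (hα.trans hlt)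
  obtain ⟨B, hB⟩ := hσ.exists_ae_norm_sawtoothError_le hL (hα0.trans (hα.trans hβ)) hβq
  obtain ⟨K, hK⟩ := exists_eLpNorm_le_of_ae_norm_le_min_rpow (L := L) hp ((lt_div_iff₀ hp0).1 hα)
    ((div_lt_iff₀ hp0).1 hβ)
  refine ⟨max 0 (max A B) * K, fun Ω hΩ => hK _ (le_max_left _ _) hΩ ?_⟩
  have hA := hA Ω hΩ
  have hB := hB Ω hΩ
  rw [← Measure.restrict_congr_set Ioo_ae_eq_Ioc] at hA hB ⊢
  filter_upwards [hA, hB, ae_restrict_mem measurableSet_Ioo] with x hxA hxB ⟨hx0, hxL⟩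
  have hmin : 0 < min x (L - x) := lt_min hx0 (sub_pos.2 hxL)
  rw [mul_min_of_nonneg _ _ (le_max_left _ _)]
  refine le_min (hxA.trans ?_) (hxB.trans ?_) <;> gcongr <;> simp

end Sawtooth

section Periodic

variable {E : Type*} {f : ℝ → E} {L : ℝ}

theorem eLpNorm_restrict_Ioc_eq_of_periodic [NormedAddCommGroup E] (hL : 0 < L)
    (hf : Function.Periodic f L) (p : ENNReal) (s t : ℝ) :
    eLpNorm f p (volume.restrict (Set.Ioc s (s + L))) =
      eLpNorm f p (volume.restrict (Set.Ioc t (t + L))) := by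
  have hs := isAddFundamentalDomain_Ioc hL s
  have ht := isAddFundamentalDomain_Ioc hL t
  rcases eq_or_ne p 0 with rfl | hp0
  · simp only [eLpNorm_exponent_zero]
  rcases eq_or_ne p ⊤ with rfl | hp
  · simp only [eLpNorm_exponent_top, eLpNormEssSup]
    have henorm (n : AddSubgroup.zmultiples L) (x : ℝ) : ‖f (n +ᵥ x)‖ₑ = ‖f x‖ₑ := by
      rw [hf.map_vadd_zmultiples]
    rw [hs.essSup_measure_restrict henorm, ht.essSup_measure_restrict henorm]
  · rw [eLpNorm_eq_lintegral_rpow_enorm_toReal hp0 hp,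
      eLpNorm_eq_lintegral_rpow_enorm_toReal hp0 hp,
      hs.setLIntegral_eq ht _ fun n x => by rw [hf.map_vadd_zmultiples]]

theorem eLpNorm_comp_sub_right_of_periodic [NormedAddCommGroup E] (hL : 0 < L)
    (hf : Function.Periodic f L) (hfm : StronglyMeasurable f) (p : ENNReal) (c : ℝ) :
    eLpNorm (fun x => f (x - c)) p (volume.restrict (Set.Ioc 0 L)) =
      eLpNorm f p (volume.restrict (Set.Ioc 0 L)) := by
  have hpre : (fun x : ℝ => x - c) ⁻¹' Set.Ioc (-c) (-c + L) = Set.Ioc 0 L := by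
    rw [Set.preimage_sub_const_Ioc]
    simp
  have hmp := (measurePreserving_sub_right volume c).restrict_preimage
    (measurableSet_Ioc (a := -c) (b := -c + L))
  rw [hpre] at hmp
  have h := eLpNorm_comp_measurePreserving (p := p) hfm.aestronglyMeasurable hmp
  rw [eLpNorm_restrict_Ioc_eq_of_periodic hL hf p (-c) 0, zero_add] at h
  exact h

theorem integral_comp_sub_left_of_periodic [NormedAddCommGroup E] [NormedSpace ℝ E]
    (hf : Function.Periodic f L) (x : ℝ) : ∫ y in 0..L, f (x - y) = ∫ y in 0..L, f y := by
  rw [intervalIntegral.integral_comp_sub_left, sub_zero]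
  simpa using hf.intervalIntegral_add_eq (x - L) 0

end Periodic

section Superposition

variable {L : ℝ} {g : ℝ → ℂ} {σ : ℝ → ℝ} {Ω : ℝ}

theorem hasDerivAt_filteredReconstruction_sawtooth (hL : 0 < L) (hσ : σ 0 = 1) (hΩ : 0 < Ω)
    (x : ℝ) : HasDerivAt (filteredReconstruction hL (sawtooth L) σ Ω)
      (filterKernel L σ Ω x - 1) x := by
  have hpi := Real.pi_pos
  rw [filteredReconstruction_eq_sum]
  refine (HasDerivAt.fun_sum fun k _ => (hasDerivAt_fourier L k x).const_mul _).congr_deriv ?_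
  have h0 : (0 : ℤ) ∈ Finset.Icc (-⌊L * Ω / (2 * Real.pi)⌋) ⌊L * Ω / (2 * Real.pi)⌋ := by
    have : 0 ≤ ⌊L * Ω / (2 * Real.pi)⌋ := Int.floor_nonneg.2 (by positivity)
    exact Finset.mem_Icc.2 ⟨neg_nonpos.2 this, this⟩
  rw [filterKernel, ← Finset.sum_erase_add _ _ h0, ← Finset.sum_erase_add _ _ h0]
  simp only [Int.cast_zero, mul_zero, hσ, zero_div, add_zero, fourier_zero,
    Complex.ofReal_one, mul_one, add_sub_cancel_right]
  refine Finset.sum_congr rfl fun k hk => ?_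
  have hkc : (k : ℂ) ≠ 0 := Int.cast_ne_zero.2 (Finset.ne_of_mem_erase hk)
  have hpic : (Real.pi : ℂ) ≠ 0 := Complex.ofReal_ne_zero.2 hpi.ne'
  have hLc : (L : ℂ) ≠ 0 := Complex.ofReal_ne_zero.2 hL.ne'
  rw [fourierCoeffOn_sawtooth]
  field_simp [Complex.I_ne_zero]

theorem integral_mul_filterKernel_sub (hL : 0 < L) (hσ : σ 0 = 1) (hΩ : 0 < Ω)
    (hg : ContDiff ℝ 1 g) (a b x : ℝ) :
    ∫ y in a..b, g y * filterKernel L σ Ω (x - y) =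
      (∫ y in a..b, g y) + g a * filteredReconstruction hL (sawtooth L) σ Ω (x - a) -
        g b * filteredReconstruction hL (sawtooth L) σ Ω (x - b) +
        ∫ y in a..b, deriv g y * filteredReconstruction hL (sawtooth L) σ Ω (x - y) := by
  have hkernel : Continuous fun y => filterKernel L σ Ω (x - y) :=
    (continuous_filterKernel L σ Ω).comp (continuous_const.sub continuous_id)
  have hparts := intervalIntegral.integral_mul_deriv_eq_deriv_mul (a := a) (b := b)
    (fun y _ => (hg.differentiable one_ne_zero y).hasDerivAt)
    (fun y _ => ((hasDerivAt_filteredReconstruction_sawtooth hL hσ hΩ (x - y)).comp_const_sub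
      x y).fun_neg)
    ((hg.continuous_deriv le_rfl).intervalIntegrable a b)
    (((hkernel.sub continuous_const).neg.neg).intervalIntegrable a b)
  simp only [neg_neg, mul_sub, mul_one, mul_neg, intervalIntegral.integral_neg] at hparts
  rw [intervalIntegral.integral_sub ((hg.continuous.fun_mul hkernel).intervalIntegrable a b)
    (hg.continuous.intervalIntegrable a b)] at hparts
  linear_combination hparts

theorem integral_deriv_mul_of_eq_const_add {S : ℝ → ℂ} (hg : ContDiff ℝ 1 g) {c d : ℝ}
    (hcd : c ≤ d) {κ : ℂ} (hS : ∀ y ∈ Set.Ioo c d, S y = κ + y) :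
    ∫ y in c..d, deriv g y * S y = g d * (κ + d) - g c * (κ + c) - ∫ y in c..d, g y := by
  have hparts := intervalIntegral.integral_mul_deriv_eq_deriv_mul (a := c) (b := d)
    (fun y _ => Complex.ofRealCLM.hasDerivAt.const_add κ)
    (fun y _ => (hg.differentiable one_ne_zero y).hasDerivAt)
    intervalIntegrable_const ((hg.continuous_deriv le_rfl).intervalIntegrable c d)
  have hcongr : ∫ y in c..d, deriv g y * S y = ∫ y in c..d, (κ + y) * deriv g y :=
    intervalIntegral.integral_congr_Ioo_of_le hcd fun y hy => by
      simp only [hS y hy, mul_comm (deriv g y)]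
  rw [hcongr]
  simpa [mul_comm (g _)] using hparts

theorem intervalIntegrable_sawtooth_const_sub (hL : 0 ≤ L) (x c d : ℝ) :
    IntervalIntegrable (fun y => sawtooth L (x - y)) volume c d :=
  (intervalIntegrable_const (c := L)).mono_fun'
    ((measurable_sawtooth L).comp (measurable_const_sub x)).aestronglyMeasurable
    (ae_of_all _ fun _ => norm_sawtooth_le hL _)

theorem intervalIntegrable_sawtoothError_const_sub (hL : 0 < L) (σ : ℝ → ℝ) (Ω x c d : ℝ) :
    IntervalIntegrable (fun y => sawtoothError hL σ Ω (x - y)) volume c d :=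
  (intervalIntegrable_sawtooth_const_sub hL.le x c d).sub
    (((continuous_filteredReconstruction hL _ σ Ω).comp
      (continuous_const.sub continuous_id)).intervalIntegrable c d)

theorem integral_deriv_mul_sawtooth (hg : ContDiff ℝ 1 g) {a b : ℝ} (ha : 0 ≤ a) (hab : a ≤ b)
    (hb : b ≤ L) {x : ℝ} (hx : x ∈ Set.Ioo 0 L) (hxa : x ≠ a) (hxb : x ≠ b) :
    L * (Set.Ioc a b).indicator g x =
      (∫ y in a..b, g y) + g a * sawtooth L (x - a) - g b * sawtooth L (x - b) +
        ∫ y in a..b, deriv g y * sawtooth L (x - y) := by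
  have hleft {y : ℝ} (hy0 : 0 ≤ y) (hyx : y ≤ x) : sawtooth L (x - y) = (L / 2 - x) + y := by
    rw [sawtooth_of_mem_Ico ⟨sub_nonneg.2 hyx, by linarith [hx.2]⟩]
    push_cast
    ring
  have hint (c d : ℝ) : IntervalIntegrable (fun y => deriv g y * sawtooth L (x - y)) volume c d :=
    (intervalIntegrable_sawtooth_const_sub (hx.1.trans hx.2).le x c d).continuousOn_mul
      (hg.continuous_deriv le_rfl).continuousOn
  have hright {y : ℝ} (hxy : x < y) (hyL : y ≤ L) : sawtooth L (x - y) = (-(L / 2) - x) + y := by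
    rw [sawtooth_of_mem_Ico_neg ⟨by linarith [hx.1], sub_neg.2 hxy⟩]
    push_cast
    ring
  rcases hxa.lt_or_gt with hxa | hxa
  · rw [integral_deriv_mul_of_eq_const_add hg hab fun y hy =>
        hright (hxa.trans hy.1) (hy.2.le.trans hb),
      hright hxa (hab.trans hb), hright (hxa.trans_le hab) hb,
      Set.indicator_of_notMem fun h => hxa.not_gt h.1]
    ring
  rcases hxb.lt_or_gt with hxb | hxb
  · rw [← intervalIntegral.integral_add_adjacent_intervals (hint a x) (hint x b),
      ← intervalIntegral.integral_add_adjacent_intervals (hg.continuous.intervalIntegrable a x)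
        (hg.continuous.intervalIntegrable x b),
      integral_deriv_mul_of_eq_const_add hg hxa.le fun y hy =>
        hleft (ha.trans hy.1.le) hy.2.le,
      integral_deriv_mul_of_eq_const_add hg hxb.le fun y hy =>
        hright hy.1 (hy.2.le.trans hb),
      hleft ha hxa.le, hright hxb hb, Set.indicator_of_mem (Set.mem_Ioc.2 ⟨hxa, hxb.le⟩)]
    ring
  · rw [integral_deriv_mul_of_eq_const_add hg hab fun y hy =>
        hleft (ha.trans hy.1.le) (hy.2.le.trans hxb.le),
      hleft ha hxa.le, hleft (ha.trans hab) hxb.le,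
      Set.indicator_of_notMem fun h => hxb.not_ge h.2]
    ring

theorem intervalIntegrable_indicator_Ioc (hg : ContDiff ℝ 1 g) (a b : ℝ) :
    IntervalIntegrable ((Set.Ioc a b).indicator g) volume 0 L :=
  intervalIntegrable_iff.2 <| (intervalIntegrable_iff.1
    (hg.continuous.intervalIntegrable 0 L)).indicator measurableSet_Ioc

theorem mul_filteredReconstruction_indicator (hL : 0 < L) (hσ : σ 0 = 1) (hΩ : 0 < Ω)
    (hg : ContDiff ℝ 1 g) {a b : ℝ} (ha : 0 ≤ a) (hab : a ≤ b) (hb : b ≤ L) (x : ℝ) :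
    L * filteredReconstruction hL ((Set.Ioc a b).indicator g) σ Ω x =
      (∫ y in a..b, g y) + g a * filteredReconstruction hL (sawtooth L) σ Ω (x - a) -
        g b * filteredReconstruction hL (sawtooth L) σ Ω (x - b) +
        ∫ y in a..b, deriv g y * filteredReconstruction hL (sawtooth L) σ Ω (x - y) := by
  rw [← integral_mul_filterKernel_sub hL hσ hΩ hg,
    filteredReconstruction_eq_integral hL (intervalIntegrable_indicator_Ioc hg a b),
    mul_inv_cancel_left₀ (Complex.ofReal_ne_zero.2 hL.ne'),
    intervalIntegral.integral_of_le hL.le, intervalIntegral.integral_of_le hab]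
  rw [← Set.inter_eq_right.2 (Set.Ioc_subset_Ioc ha hb), ← setIntegral_indicator measurableSet_Ioc]
  simp only [Set.indicator_mul_left, Set.inter_eq_right.2 (Set.Ioc_subset_Ioc ha hb)]

theorem mul_indicator_sub_filteredReconstruction (hL : 0 < L) (hσ : σ 0 = 1) (hΩ : 0 < Ω)
    (hg : ContDiff ℝ 1 g) {a b : ℝ} (ha : 0 ≤ a) (hab : a ≤ b) (hb : b ≤ L) {x : ℝ}
    (hx : x ∈ Set.Ioo 0 L) (hxa : x ≠ a) (hxb : x ≠ b) :
    L * ((Set.Ioc a b).indicator g x -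
        filteredReconstruction hL ((Set.Ioc a b).indicator g) σ Ω x) =
      g a * sawtoothError hL σ Ω (x - a) - g b * sawtoothError hL σ Ω (x - b) +
        ∫ y in a..b, deriv g y * sawtoothError hL σ Ω (x - y) := by
  have hrec : Continuous fun y =>
      deriv g y * filteredReconstruction hL (sawtooth L) σ Ω (x - y) :=
    (hg.continuous_deriv le_rfl).mul
      ((continuous_filteredReconstruction hL _ σ Ω).comp (continuous_const.sub continuous_id))
  simp only [sawtoothError, mul_sub]
  rw [intervalIntegral.integral_sub ((intervalIntegrable_sawtooth_const_sub hL.le x a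
      b).continuousOn_mul (hg.continuous_deriv le_rfl).continuousOn) (hrec.intervalIntegrable a b),
    integral_deriv_mul_sawtooth hg ha hab hb hx hxa hxb,
    mul_filteredReconstruction_indicator hL hσ hΩ hg ha hab hb]
  ring

theorem norm_integral_deriv_mul_sawtoothError_le (hL : 0 < L) (σ : ℝ → ℝ) (Ω : ℝ) {a b M : ℝ}
    (ha : 0 ≤ a) (hab : a ≤ b) (hb : b ≤ L) (hM : ∀ y ∈ Set.Icc a b, ‖deriv g y‖ ≤ M) (x : ℝ) :
    ‖∫ y in a..b, deriv g y * sawtoothError hL σ Ω (x - y)‖ ≤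
      M * ∫ y in 0..L, ‖sawtoothError hL σ Ω y‖ := by
  have hper : Function.Periodic (fun y => ‖sawtoothError hL σ Ω y‖) L := fun y =>
    congrArg norm (periodic_sawtoothError hL σ Ω y)
  have hint (c d : ℝ) : IntervalIntegrable (fun y => ‖sawtoothError hL σ Ω (x - y)‖)
      volume c d := (intervalIntegrable_sawtoothError_const_sub hL σ Ω x c d).norm
  have hM0 : 0 ≤ M := (norm_nonneg _).trans (hM a (Set.left_mem_Icc.2 hab))
  calc ‖∫ y in a..b, deriv g y * sawtoothError hL σ Ω (x - y)‖
      ≤ ∫ y in a..b, M * ‖sawtoothError hL σ Ω (x - y)‖ := by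
        refine intervalIntegral.norm_integral_le_of_norm_le hab (ae_of_all _ fun y hy => ?_)
          ((hint a b).const_mul M)
        rw [norm_mul]
        gcongr
        exact hM y (Set.Ioc_subset_Icc_self hy)
    _ = M * ∫ y in a..b, ‖sawtoothError hL σ Ω (x - y)‖ :=
        intervalIntegral.integral_const_mul _ _
    _ ≤ M * ∫ y in 0..L, ‖sawtoothError hL σ Ω (x - y)‖ := by
        gcongr
        exact intervalIntegral.integral_mono_interval ha hab hb (ae_of_all _ fun y => norm_nonneg _)
          (hint 0 L)
    _ = M * ∫ y in 0..L, ‖sawtoothError hL σ Ω y‖ := by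
        rw [integral_comp_sub_left_of_periodic hper]

theorem eLpNorm_const_integral_norm_le (hL : 0 < L) {E : Type*} [NormedAddCommGroup E]
    {f : ℝ → E} (hf : AEStronglyMeasurable f (volume.restrict (Set.Ioc 0 L))) {p : ENNReal}
    (hp : 1 ≤ p) :
    eLpNorm (fun _ : ℝ => ∫ y in 0..L, ‖f y‖) p (volume.restrict (Set.Ioc 0 L)) ≤
      ENNReal.ofReal L * eLpNorm f p (volume.restrict (Set.Ioc 0 L)) := by
  have hvol : volume.restrict (Set.Ioc 0 L) Set.univ = ENNReal.ofReal L := by simp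
  have hL0 : ENNReal.ofReal L ≠ 0 := by simpa using hL
  have henorm : ‖∫ y in 0..L, ‖f y‖‖ₑ ≤ eLpNorm f 1 (volume.restrict (Set.Ioc 0 L)) := by
    rw [intervalIntegral.integral_of_le hL.le, eLpNorm_one_eq_lintegral_enorm]
    exact (enorm_integral_le_lintegral_enorm _).trans_eq (by simp only [enorm_norm])
  rw [eLpNorm_const _ (one_pos.trans_le hp).ne' fun h => hL0 (by rw [← hvol, h]; rfl), hvol]
  calc ‖∫ y in 0..L, ‖f y‖‖ₑ * ENNReal.ofReal L ^ (1 / p.toReal)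
      ≤ eLpNorm f p (volume.restrict (Set.Ioc 0 L)) *
          ENNReal.ofReal L ^ (1 / (1 : ENNReal).toReal - 1 / p.toReal) *
          ENNReal.ofReal L ^ (1 / p.toReal) := by
        gcongr
        exact henorm.trans (hvol ▸ eLpNorm_le_eLpNorm_mul_rpow_measure_univ hp hf)
    _ = ENNReal.ofReal L * eLpNorm f p (volume.restrict (Set.Ioc 0 L)) := by
        rw [mul_assoc, ← ENNReal.rpow_add _ _ hL0 ENNReal.ofReal_ne_top]
        simp [mul_comm]

theorem exists_norm_le_and_norm_deriv_le (hg : ContDiff ℝ 1 g) (a b : ℝ) :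
    ∃ M : NNReal, ∀ y ∈ Set.Icc a b, ‖g y‖ ≤ M ∧ ‖deriv g y‖ ≤ M := by
  obtain ⟨A, hA⟩ := isCompact_Icc.exists_bound_of_continuousOn (s := Set.Icc a b)
    hg.continuous.continuousOn
  obtain ⟨B, hB⟩ := isCompact_Icc.exists_bound_of_continuousOn (s := Set.Icc a b)
    (hg.continuous_deriv le_rfl).continuousOn
  exact ⟨(max A B).toNNReal, fun y hy =>
    ⟨(hA y hy).trans ((le_max_left A B).trans (Real.le_coe_toNNReal _)),
      (hB y hy).trans ((le_max_right A B).trans (Real.le_coe_toNNReal _))⟩⟩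

theorem exists_norm_indicator_sub_filteredReconstruction_le (hL : 0 < L) (hσ : σ 0 = 1)
    (hg : ContDiff ℝ 1 g) {a b : ℝ} (ha : 0 ≤ a) (hab : a ≤ b) (hb : b ≤ L) :
    ∃ K : NNReal, ∀ Ω : ℝ, 0 < Ω → ∀ᵐ x ∂volume.restrict (Set.Ioc 0 L),
      ‖(Set.Ioc a b).indicator g x -
          filteredReconstruction hL ((Set.Ioc a b).indicator g) σ Ω x‖ ≤
        K * (‖sawtoothError hL σ Ω (x - a)‖ + ‖sawtoothError hL σ Ω (x - b)‖ +
          ∫ y in 0..L, ‖sawtoothError hL σ Ω y‖) := by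
  obtain ⟨M, hM⟩ := exists_norm_le_and_norm_deriv_le hg a b
  refine ⟨M / L.toNNReal, fun Ω hΩ => ?_⟩
  rw [← Measure.restrict_congr_set Ioo_ae_eq_Ioc]
  filter_upwards [ae_restrict_mem measurableSet_Ioo, ae_restrict_of_ae (Measure.ae_ne volume a),
    ae_restrict_of_ae (Measure.ae_ne volume b)] with x hx hxa hxb
  have hId := mul_indicator_sub_filteredReconstruction hL hσ hΩ hg ha hab hb hx hxa hxb
  rw [NNReal.coe_div, Real.coe_toNNReal L hL.le, div_mul_eq_mul_div, le_div_iff₀' hL]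
  calc L * ‖(Set.Ioc a b).indicator g x -
        filteredReconstruction hL ((Set.Ioc a b).indicator g) σ Ω x‖
      = ‖g a * sawtoothError hL σ Ω (x - a) - g b * sawtoothError hL σ Ω (x - b) +
          ∫ y in a..b, deriv g y * sawtoothError hL σ Ω (x - y)‖ := by
        rw [← hId, norm_mul, Complex.norm_real, Real.norm_of_nonneg hL.le]
    _ ≤ ‖g a‖ * ‖sawtoothError hL σ Ω (x - a)‖ + ‖g b‖ * ‖sawtoothError hL σ Ω (x - b)‖ +
          ‖∫ y in a..b, deriv g y * sawtoothError hL σ Ω (x - y)‖ := by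
        rw [← norm_mul, ← norm_mul]
        exact (norm_add_le _ _).trans (add_le_add_left (norm_sub_le _ _) _)
    _ ≤ M * ‖sawtoothError hL σ Ω (x - a)‖ + M * ‖sawtoothError hL σ Ω (x - b)‖ +
          M * ∫ y in 0..L, ‖sawtoothError hL σ Ω y‖ := by
        gcongr
        · exact (hM a (Set.left_mem_Icc.2 hab)).1
        · exact (hM b (Set.right_mem_Icc.2 hab)).1
        · exact norm_integral_deriv_mul_sawtoothError_le hL σ Ω ha hab hb
            (fun y hy => (hM y hy).2) x
    _ = _ := by ring

theorem eLpNorm_sawtoothError_superposition_le (hL : 0 < L) (σ : ℝ → ℝ) (Ω a b : ℝ)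
    {p : ENNReal} (hp : 1 ≤ p) :
    eLpNorm (fun x => ‖sawtoothError hL σ Ω (x - a)‖ + ‖sawtoothError hL σ Ω (x - b)‖ +
        ∫ y in 0..L, ‖sawtoothError hL σ Ω y‖) p (volume.restrict (Set.Ioc 0 L)) ≤
      (2 + ENNReal.ofReal L) *
        eLpNorm (sawtoothError hL σ Ω) p (volume.restrict (Set.Ioc 0 L)) := by
  have hmeas := measurable_sawtoothError hL σ Ω
  have hshift (c : ℝ) := eLpNorm_comp_sub_right_of_periodic hL (periodic_sawtoothError hL σ Ω)
    hmeas.stronglyMeasurable p c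
  have hmeas_shift (c : ℝ) : AEStronglyMeasurable (fun x => ‖sawtoothError hL σ Ω (x - c)‖)
      (volume.restrict (Set.Ioc 0 L)) :=
    (hmeas.comp (measurable_sub_const c)).norm.aestronglyMeasurable
  refine (eLpNorm_add_le ((hmeas_shift a).add (hmeas_shift b)) aestronglyMeasurable_const
    hp).trans ?_
  rw [add_mul, two_mul]
  refine add_le_add ((eLpNorm_add_le (hmeas_shift a) (hmeas_shift b) hp).trans_eq ?_)
    (eLpNorm_const_integral_norm_le hL hmeas.aestronglyMeasurable hp)
  rw [eLpNorm_norm, eLpNorm_norm, hshift, hshift]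

/-- The error of the filtered reconstruction of `f` in `L^p` of a period is at most a constant
multiple, independent of the cutoff, of the corresponding error for the sawtooth wave. -/
structure IsSawtoothControlled (hL : 0 < L) (σ : ℝ → ℝ) (p : ENNReal) (f : ℝ → ℂ) : Prop where
  intervalIntegrable : IntervalIntegrable f volume 0 L
  exists_eLpNorm_le : ∃ K : NNReal, ∀ Ω : ℝ, 0 < Ω →
    eLpNorm (fun x => f x - filteredReconstruction hL f σ Ω x) p
        (volume.restrict (Set.Ioc 0 L)) ≤
      K * eLpNorm (sawtoothError hL σ Ω) p (volume.restrict (Set.Ioc 0 L))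

namespace IsSawtoothControlled

variable {hL : 0 < L} {p : ENNReal} {f h : ℝ → ℂ}

theorem congr_ae (hf : IsSawtoothControlled hL σ p f)
    (hfh : f =ᵐ[volume.restrict (Set.Ioc 0 L)] h) : IsSawtoothControlled hL σ p h := by
  obtain ⟨K, hK⟩ := hf.exists_eLpNorm_le
  refine ⟨(intervalIntegrable_congr_ae (by rwa [Set.uIoc_of_le hL.le])).1 hf.intervalIntegrable,
    K, fun Ω hΩ => (eLpNorm_congr_ae ?_).trans_le (hK Ω hΩ)⟩
  rw [filteredReconstruction_congr_ae hL hfh]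
  filter_upwards [hfh] with x hx
  rw [hx]

theorem add (hp : 1 ≤ p) (hf : IsSawtoothControlled hL σ p f)
    (hh : IsSawtoothControlled hL σ p h) : IsSawtoothControlled hL σ p fun x => f x + h x := by
  obtain ⟨K, hK⟩ := hf.exists_eLpNorm_le
  obtain ⟨K', hK'⟩ := hh.exists_eLpNorm_le
  have hmeas {u : ℝ → ℂ} (hu : IntervalIntegrable u volume 0 L) (Ω : ℝ) :
      AEStronglyMeasurable (fun x => u x - filteredReconstruction hL u σ Ω x)
        (volume.restrict (Set.Ioc 0 L)) :=
    ((intervalIntegrable_iff_integrableOn_Ioc_of_le hL.le).1 hu).aestronglyMeasurable.sub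
      (continuous_filteredReconstruction hL u σ Ω).aestronglyMeasurable
  refine ⟨hf.intervalIntegrable.add hh.intervalIntegrable, K + K', fun Ω hΩ => ?_⟩
  simp only [filteredReconstruction_add hL hf.intervalIntegrable hh.intervalIntegrable,
    add_sub_add_comm]
  refine (eLpNorm_add_le (hmeas hf.intervalIntegrable Ω) (hmeas hh.intervalIntegrable Ω)
    hp).trans ?_
  rw [ENNReal.coe_add, add_mul]
  exact add_le_add (hK Ω hΩ) (hK' Ω hΩ)

theorem indicator_Ioc_of_contDiff (hσ : σ 0 = 1) (hp : 1 ≤ p) (hg : ContDiff ℝ 1 g) {a b : ℝ}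
    (ha : 0 ≤ a) (hab : a ≤ b) (hb : b ≤ L) :
    IsSawtoothControlled hL σ p ((Set.Ioc a b).indicator g) := by
  obtain ⟨K, hK⟩ := exists_norm_indicator_sub_filteredReconstruction_le hL hσ hg ha hab hb
  refine ⟨intervalIntegrable_indicator_Ioc hg a b, K * (2 + L.toNNReal), fun Ω hΩ => ?_⟩
  have hle := eLpNorm_le_mul_eLpNorm_of_ae_le_mul ((hK Ω hΩ).mono fun x hx =>
    hx.trans (mul_le_mul_of_nonneg_left (Real.le_norm_self _) K.coe_nonneg)) p
  rw [ENNReal.ofReal_coe_nnreal] at hle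
  refine (hle.trans (mul_le_mul_right
    (eLpNorm_sawtoothError_superposition_le hL σ Ω a b hp) _)).trans_eq ?_
  rw [ENNReal.coe_mul, mul_assoc]
  rfl

theorem indicator_Ioc_of_piecewise (hσ : σ 0 = 1) (hp : 1 ≤ p) {F : ℝ → ℂ} {P : ℝ → Prop}
    (hF : ∀ a b : ℝ, a < b → (∀ y ∈ Set.Ioo a b, ¬ P y) →
      ∃ g : ℝ → ℂ, ContDiff ℝ 1 g ∧ Set.EqOn F g (Set.Ioo a b))
    (s : Finset ℝ) {a b : ℝ} (ha : 0 ≤ a) (hab : a < b) (hb : b ≤ L)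
    (hs : ∀ y ∈ Set.Ioo a b, P y → y ∈ s) :
    IsSawtoothControlled hL σ p ((Set.Ioc a b).indicator F) := by
  induction s using Finset.induction_on generalizing a b with
  | empty =>
    obtain ⟨g, hg, hFg⟩ := hF a b hab fun y hy hPy => Finset.notMem_empty y (hs y hy hPy)
    refine (indicator_Ioc_of_contDiff hσ hp hg ha hab.le hb).congr_ae ?_
    filter_upwards [ae_restrict_of_ae (Measure.ae_ne volume b)] with x hxb
    by_cases hx : x ∈ Set.Ioc a b
    · rw [Set.indicator_of_mem hx, Set.indicator_of_mem hx, hFg ⟨hx.1, hx.2.lt_of_ne hxb⟩]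
    · rw [Set.indicator_of_notMem hx, Set.indicator_of_notMem hx]
  | insert c s _ ih =>
    by_cases hc : c ∈ Set.Ioo a b
    · have hac := ih ha hc.1 (hc.2.le.trans hb) fun y hy hPy =>
        (Finset.mem_insert.1 (hs y ⟨hy.1, hy.2.trans hc.2⟩ hPy)).resolve_left hy.2.ne
      have hcb := ih (ha.trans hc.1.le) hc.2 hb fun y hy hPy =>
        (Finset.mem_insert.1 (hs y ⟨hc.1.trans hy.1, hy.2⟩ hPy)).resolve_left hy.1.ne'
      rw [← Set.Ioc_union_Ioc_eq_Ioc hc.1.le hc.2.le,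
        Set.indicator_union_of_disjoint (Set.Ioc_disjoint_Ioc_of_le le_rfl)]
      exact hac.add hp hcb
    · exact ih ha hab hb fun y hy hPy =>
        (Finset.mem_insert.1 (hs y hy hPy)).resolve_left fun h => hc (h ▸ hy)

end IsSawtoothControlled

theorem IsPeriodicPiecewiseContDiff.isSawtoothControlled {J : ℕ} {ξ : Fin J → ℝ} {F : ℝ → ℂ}
    (hF : IsPeriodicPiecewiseContDiff L 1 ξ F) (hL : 0 < L) (hσ : σ 0 = 1) {p : ENNReal}
    (hp : 1 ≤ p) : IsSawtoothControlled hL σ p F := by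
  classical
  let s : Finset ℝ := Finset.univ.biUnion fun j : Fin J =>
    (Finset.Icc ⌈(0 - ξ j) / L⌉ ⌊(L - ξ j) / L⌋).image fun n : ℤ => ξ j + n * L
  have hs : ∀ y ∈ Set.Ioo 0 L, (∃ (j : Fin J) (n : ℤ), ξ j + n * L = y) → y ∈ s := by
    rintro _ hy ⟨j, n, rfl⟩
    refine Finset.mem_biUnion.2 ⟨j, Finset.mem_univ j, Finset.mem_image_of_mem _ ?_⟩
    rw [Finset.mem_Icc, Int.ceil_le, div_le_iff₀ hL, Int.le_floor, le_div_iff₀ hL]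
    exact ⟨by linarith [hy.1], by linarith [hy.2]⟩
  have hpiece : ∀ a b : ℝ, a < b →
      (∀ y ∈ Set.Ioo a b, ¬ ∃ (j : Fin J) (n : ℤ), ξ j + n * L = y) →
      ∃ g : ℝ → ℂ, ContDiff ℝ 1 g ∧ Set.EqOn F g (Set.Ioo a b) := fun a b hab hy => by
    simpa only [Nat.cast_one] using hF.piecewise a b hab fun j n h => hy _ h ⟨j, n, rfl⟩
  refine (IsSawtoothControlled.indicator_Ioc_of_piecewise hσ hp hpiece s le_rfl hL le_rfl
    hs).congr_ae ?_
  filter_upwards [ae_restrict_mem measurableSet_Ioc] with x hx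
  exact Set.indicator_of_mem hx F

end Superposition

theorem IsPeriodicPiecewiseContDiff.of_le {L : ℝ} {m q J : ℕ} {ξ : Fin J → ℝ} {F : ℝ → ℂ}
    (hF : IsPeriodicPiecewiseContDiff L q ξ F) (hm : m ≤ q) :
    IsPeriodicPiecewiseContDiff L m ξ F where
  periodic := hF.periodic
  piecewise a b hab hξ := by
    obtain ⟨g, hg, hFg⟩ := hF.piecewise a b hab hξ
    exact ⟨g, hg.of_le (by exact_mod_cast hm), hFg⟩

theorem mainTheorem1_general {L : ℝ} (hL : 0 < L) {q J : ℕ} {ξ : Fin J → ℝ} {F : ℝ → ℂ}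
    {σ : ℝ → ℝ} (hF : IsPeriodicPiecewiseContDiff L 1 ξ F) (hσ : IsSpectralFilter q σ) {p : ℝ}
    (hp : 1 ≤ p) (hpq : 1 < p * ((q : ℝ) - 1)) :
    ∃ C : ℝ, ∀ Ω : ℝ, 0 < Ω →
      eLpNorm (fun x => F x - filteredReconstruction hL F σ Ω x) (ENNReal.ofReal p)
        (volume.restrict (Set.Icc 0 L)) ≤ ENNReal.ofReal (C * Ω ^ (-(1 / p))) := by
  obtain ⟨K, hK⟩ := (hF.isSawtoothControlled hL hσ.map_zero
    (ENNReal.one_le_ofReal.2 hp)).exists_eLpNorm_le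
  obtain ⟨C, hC⟩ := hσ.exists_eLpNorm_sawtoothError_le hL hp hpq
  refine ⟨K * C, fun Ω hΩ => ?_⟩
  rw [← Measure.restrict_congr_set Ioc_ae_eq_Icc, mul_assoc, ENNReal.ofReal_mul K.coe_nonneg,
    ENNReal.ofReal_coe_nnreal]
  exact (hK Ω hΩ).trans (mul_le_mul_right (hC Ω hΩ) _)

theorem mainTheorem1 {L : ℝ} (hL : 0 < L) {q J : ℕ} {ξ : Fin J → ℝ} {F : ℝ → ℂ} {σ : ℝ → ℝ}
    (hF : IsPeriodicPiecewiseContDiff L q ξ F) (hσ : IsSpectralFilter q σ) :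
    (∀ p : ℝ, 1 ≤ p → 1 < p * ((q : ℝ) - 1) →
      ∃ C : ℝ, ∀ᶠ Ω : ℝ in atTop,
        eLpNorm (fun x => F x - filteredReconstruction hL F σ Ω x) (ENNReal.ofReal p)
          (volume.restrict (Set.Icc 0 L)) ≤ ENNReal.ofReal (C * Ω ^ (-(1 / p)))) ∧
    (1 < (q : ℝ) - 1 →
      ∃ C : ℝ, ∀ᶠ Ω : ℝ in atTop,
        eLpNorm (fun x => F x - filteredReconstruction hL F σ Ω x) 1
          (volume.restrict (Set.Icc 0 L)) ≤ ENNReal.ofReal (C * Ω⁻¹)) := by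
  have key (p : ℝ) (hp : 1 ≤ p) (hpq : 1 < p * ((q : ℝ) - 1)) :
      ∃ C : ℝ, ∀ᶠ Ω : ℝ in atTop,
        eLpNorm (fun x => F x - filteredReconstruction hL F σ Ω x) (ENNReal.ofReal p)
          (volume.restrict (Set.Icc 0 L)) ≤ ENNReal.ofReal (C * Ω ^ (-(1 / p))) := by
    have hq : (1 : ℝ) ≤ q := by nlinarith
    obtain ⟨C, hC⟩ := mainTheorem1_general hL (hF.of_le (by exact_mod_cast hq)) hσ hp hpq
    exact ⟨C, (eventually_gt_atTop 0).mono hC⟩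
  exact ⟨key, fun hq => by simpa [Real.rpow_neg_one] using key 1 le_rfl (by simpa using hq)⟩
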